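/- Let $a,b,p\in\mathbb{Q}$ with $p>0$ and $\sqrt p\notin\mathbb{Q}$, and put $\mathbb{Q}[\sqrt p]=\{\alpha+\beta\sqrt p:\alpha,\beta\in\mathbb{Q}\}$. A polygon is a closed connected bounded part of the plane (the closure of its interior) bounded by one or several pairwise disjoint, non-self-intersecting closed polylines; it need not be simply connected. Cutting a polygon into rectangles means representing it as the union of finitely many nondegenerate closed rectangles, in any position, with pairwise disjoint interiors. A rectangle has side ratio $r$ if one of its sides is $r$ times as long as an adjacent side (in either order). Let $M$ be a polygon all of whose side lengths belong to $\mathbb{Q}[\sqrt p]$, and suppose that $M$ can be cut into equal (congruent) rectangles with side ratio $y\in\mathbb{R}$. Let $R$ be a rectangle with side ratio $y$. Then $M$ can be cut into similar rectangles with side ratio $a+b\sqrt p$ if and only if $R$ can be cut into similar rectangles with side ratio $a+b\sqrt p$. -/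

import Mathlib

/-- The Euclidean plane. -/
abbrev Plane : Type := EuclideanSpace ℝ (Fin 2)

/-- The set `ℚ[√p] = {α + β√p : α, β ∈ ℚ}` of real numbers. -/
def quadraticNumbers (p : ℚ) : Set ℝ :=
  {x | ∃ α β : ℚ, x = (α : ℝ) + (β : ℝ) * √(p : ℝ)}

/-- A closed polyline (with vertices `γ 0, …, γ (n - 1)` in cyclic order) is simple if it has at
least three edges, all of nonzero length, and two different edges can only meet when they are
consecutive, and then only at their common vertex. -/
structure IsSimpleClosedPolyline {n : ℕ} (γ : Polygon Plane n) : Prop where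
  three_le : 3 ≤ n
  nondegenerate : γ.HasNondegenerateEdges
  inter : ∀ i j : Fin n, i ≠ j → ∀ x ∈ γ.edgeSet ℝ i ∩ γ.edgeSet ℝ j,
    (j = finRotate n i ∧ x = γ j) ∨ (i = finRotate n j ∧ x = γ i)

/-- A polygonal region: a closed connected bounded part of the plane (the closure of its interior)
whose boundary is the union of finitely many pairwise disjoint simple closed polylines. It need
not be simply connected. A straight angle at a vertex of a boundary polyline is allowed. -/
structure PolygonalRegion where
  carrier : Set Plane
  isConnected : IsConnected carrier
  isBounded : Bornology.IsBounded carrier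
  closure_interior : closure (interior carrier) = carrier
  /-- the number of boundary polylines -/
  numCurves : ℕ
  /-- the number of edges of each boundary polyline -/
  numEdges : Fin numCurves → ℕ
  curve : (i : Fin numCurves) → Polygon Plane (numEdges i)
  isSimple : ∀ i, IsSimpleClosedPolyline (curve i)
  disjoint : ∀ i j, i ≠ j → Disjoint ((curve i).boundary ℝ) ((curve j).boundary ℝ)
  frontier_eq : frontier carrier = ⋃ i, (curve i).boundary ℝ

/-- The length of the `j`-th side of the `i`-th boundary polyline. -/
noncomputable def PolygonalRegion.sideLength (M : PolygonalRegion) (i : Fin M.numCurves)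
    (j : Fin (M.numEdges i)) : ℝ :=
  dist (M.curve i j) (M.curve i (finRotate _ j))

/-- A nondegenerate rectangle in the plane, in any position: a corner and the two mutually
orthogonal nonzero side vectors that start at it. -/
structure PlaneRectangle where
  corner : Plane
  u : Plane
  v : Plane
  u_ne_zero : u ≠ 0
  v_ne_zero : v ≠ 0
  orthogonal : inner ℝ u v = 0

namespace PlaneRectangle

/-- The closed rectangle as a set of points. -/
def carrier (R : PlaneRectangle) : Set Plane :=
  {x | ∃ s ∈ Set.Icc (0 : ℝ) 1, ∃ t ∈ Set.Icc (0 : ℝ) 1, x = R.corner + s • R.u + t • R.v}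

/-- The unordered pair of side lengths. -/
noncomputable def sides (R : PlaneRectangle) : Sym2 ℝ := s(‖R.u‖, ‖R.v‖)

/-- `R` has side ratio `r`: one of its sides is `r` times as long as the other one. -/
def HasRatio (R : PlaneRectangle) (r : ℝ) : Prop :=
  ‖R.u‖ = r * ‖R.v‖ ∨ ‖R.v‖ = r * ‖R.u‖

end PlaneRectangle

/-- The set `M` is cut into the rectangles `T i`: they cover exactly `M` and their interiors are
pairwise disjoint. -/
def IsDissection (M : Set Plane) {n : ℕ} (T : Fin n → PlaneRectangle) : Prop :=
  (⋃ i, (T i).carrier) = M ∧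
    ∀ i j, i ≠ j → Disjoint (interior (T i).carrier) (interior (T j).carrier)

/-- `M` can be cut into finitely many equal (congruent) rectangles with side ratio `y`. -/
def CanBeCutIntoEqual (M : Set Plane) (y : ℝ) : Prop :=
  ∃ (n : ℕ) (T : Fin n → PlaneRectangle), IsDissection M T ∧
    (∀ i j, (T i).sides = (T j).sides) ∧ ∀ i, (T i).HasRatio y

/-- `M` can be cut into finitely many similar rectangles with side ratio `r`. -/
def CanBeCutIntoSimilar (M : Set Plane) (r : ℝ) : Prop :=
  ∃ (n : ℕ) (T : Fin n → PlaneRectangle), IsDissection M T ∧ ∀ i, (T i).HasRatio r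

/-!
Both sides of the equivalence say the same about the numbers `x = a + b √p` and `y`: that
`y = q x + q' / x` with nonnegative rational `q` and `q'` (`IsConicCombination`).

*Sufficiency.* A rectangle with side ratio `q x + q' / x` is cut by one line into rectangles with
side ratios `q x` and `q' / x`, and each of these is cut by a grid into rectangles with side
ratio `x` (`IsConicCombination.canBeCutIntoSimilar`). A set that is cut into rectangles with side
ratio `y` is then cut as well.

*An additive invariant.* For additive functions `f` and `g` on `ℝ`, assign the number
`f(u) g(v) + f(v) g(u)` to a rectangle with sides `u` and `v` (`PlaneRectangle.sideForm`). Its sum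
over the tiles of a dissection depends only on the dissected set `M`
(`IsDissection.sum_sideForm_congr`), even if the tiles are in different positions. Indeed, in the
coordinates of an orthonormal frame the value of a box `[x₁, x₂] × [y₁, y₂]` is the sum of
`± f(x) g(y)` over its corners. The sign of a corner can be read off the indicator function of the
box near that point: it is the change at the corner of the jump of the indicator function across
the line through the corner in the first direction of the frame. This local quantity
(`cornerSign`) is additive, is defined for `M` itself, and vanishes for rectangles that are not
aligned with the frame; so the tiles of each position are counted separately by a sum over `M`.

*Polygons.* If `M` is a polygon, then its corner sign vanishes except at vertices, and each edge
in the direction of the frame contributes opposite jumps at its two ends. So the sum of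
`± f(x) g(y)` is zero as soon as `f` kills all side lengths
(`HasPolygonalFrontier.cornerSum_eq_zero`). If the sides of `M` are in `ℚ[√p]` and `M` is cut into
equal rectangles, this applied to functions `f` that vanish on `ℚ[√p]` shows that the sides of these
rectangles, and therefore `y`, are in `ℚ[√p]` (`PolygonalRegion.ratio_mem_quadraticNumbers`).

*Necessity.* Suppose that a set is cut both into equal rectangles with sides `α` and `y α`, and into
rectangles with sides `sᵢ` and `x sᵢ`. Let `F(s) = s / α`, and let `G` be additive, semilinear for
the conjugation of `ℚ[√p]`, with `G(α) = 1`. Up to a common factor, the invariants for the pairs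
`(F, F)`, `(G, G)` and `(F, G)` say that `y = x A`, `y' = x' D` and `y + y' = (x + x') E`, where
`'` is the conjugation, `A = ∑ F(sᵢ)²`, `D = ∑ G(sᵢ)²` and `E = ∑ F(sᵢ) G(sᵢ)`. Since `E² ≤ A D`,
this forces `y` into the cone spanned by `x` and `1 / x` (`isConicCombination_of_forms`). The
argument applies to the polygon as well as to the single rectangle `R`.
-/

/-! ### Rectangles in terms of inner products -/

theorem Plane.inner_eq (x y : Plane) : inner ℝ x y = x 0 * y 0 + x 1 * y 1 := by
  simp [PiLp.inner_apply, Fin.sum_univ_two, mul_comm]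

theorem Plane.eq_zero_of_inner_eq_zero {u v z : Plane} (hu : u ≠ 0) (hv : v ≠ 0)
    (huv : inner ℝ u v = 0) (h1 : inner ℝ u z = 0) (h2 : inner ℝ v z = 0) : z = 0 := by
  have hu' : inner ℝ u u ≠ 0 := inner_self_ne_zero.2 hu
  have hv' : inner ℝ v v ≠ 0 := inner_self_ne_zero.2 hv
  rw [Plane.inner_eq] at *
  have hdet : u 0 * v 1 - u 1 * v 0 ≠ 0 := by
    intro h
    apply mul_ne_zero hu' hv'
    linear_combination (u 0 * v 1 - u 1 * v 0) * h + (u 0 * v 0 + u 1 * v 1) * huv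
  ext i
  fin_cases i
  · exact (mul_eq_zero.1 (show (u 0 * v 1 - u 1 * v 0) * z 0 = 0 by
      linear_combination v 1 * h1 - u 1 * h2)).resolve_left hdet
  · exact (mul_eq_zero.1 (show (u 0 * v 1 - u 1 * v 0) * z 1 = 0 by
      linear_combination u 0 * h2 - v 0 * h1)).resolve_left hdet

namespace PlaneRectangle

variable (R : PlaneRectangle)

theorem inner_u_pos : 0 < inner ℝ R.u R.u :=
  real_inner_self_pos.2 R.u_ne_zero

theorem inner_v_pos : 0 < inner ℝ R.v R.v :=
  real_inner_self_pos.2 R.v_ne_zero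

theorem inner_v_u : inner ℝ R.v R.u = 0 := by
  rw [real_inner_comm]; exact R.orthogonal

theorem mem_carrier_iff (z : Plane) : z ∈ R.carrier ↔
    (0 ≤ inner ℝ R.u (z - R.corner) ∧ inner ℝ R.u (z - R.corner) ≤ inner ℝ R.u R.u) ∧
      (0 ≤ inner ℝ R.v (z - R.corner) ∧ inner ℝ R.v (z - R.corner) ≤ inner ℝ R.v R.v) := by
  have hu := R.inner_u_pos
  have hv := R.inner_v_pos
  constructor
  · rintro ⟨s, ⟨hs0, hs1⟩, t, ⟨ht0, ht1⟩, rfl⟩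
    have : R.corner + s • R.u + t • R.v - R.corner = s • R.u + t • R.v := by abel
    rw [this]
    simp only [inner_add_right, inner_smul_right, R.orthogonal, R.inner_v_u]
    refine ⟨⟨?_, ?_⟩, ?_, ?_⟩ <;> nlinarith
  · rintro ⟨⟨h1, h2⟩, h3, h4⟩
    refine ⟨inner ℝ R.u (z - R.corner) / inner ℝ R.u R.u, ⟨by positivity, by rwa [div_le_one hu]⟩,
      inner ℝ R.v (z - R.corner) / inner ℝ R.v R.v, ⟨by positivity, by rwa [div_le_one hv]⟩, ?_⟩
    rw [← sub_eq_zero]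
    apply Plane.eq_zero_of_inner_eq_zero R.u_ne_zero R.v_ne_zero R.orthogonal
    all_goals
      rw [add_assoc, ← sub_sub]
      simp only [inner_add_right, inner_sub_right _ _ (_ + _), inner_smul_right, R.orthogonal,
        R.inner_v_u]
      field_simp
      ring

theorem mem_interior_of_lt {z : Plane}
    (h : (0 < inner ℝ R.u (z - R.corner) ∧ inner ℝ R.u (z - R.corner) < inner ℝ R.u R.u) ∧
      (0 < inner ℝ R.v (z - R.corner) ∧ inner ℝ R.v (z - R.corner) < inner ℝ R.v R.v)) :
    z ∈ interior R.carrier := by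
  have ho : IsOpen {z : Plane | (0 < inner ℝ R.u (z - R.corner) ∧
      inner ℝ R.u (z - R.corner) < inner ℝ R.u R.u) ∧
      (0 < inner ℝ R.v (z - R.corner) ∧ inner ℝ R.v (z - R.corner) < inner ℝ R.v R.v)} := by
    refine ((isOpen_lt ?_ ?_).and (isOpen_lt ?_ ?_)).and ((isOpen_lt ?_ ?_).and (isOpen_lt ?_ ?_))
    all_goals fun_prop
  refine interior_maximal ?_ ho h
  rintro w ⟨⟨h1, h2⟩, h3, h4⟩
  exact (R.mem_carrier_iff w).2 ⟨⟨h1.le, h2.le⟩, h3.le, h4.le⟩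

/-- Along a side direction, an interior point can be moved a little without leaving the set. -/
theorem exists_add_smul_mem_of_mem_interior {A : Set Plane} {z : Plane} (hz : z ∈ interior A)
    (w : Plane) : ∃ t > (0 : ℝ), z + t • w ∈ A ∧ z - t • w ∈ A := by
  have h1 : Filter.Tendsto (fun t : ℝ => z + t • w) (nhdsWithin 0 (Set.Ioi 0)) (nhds z) := by
    have : Continuous fun t : ℝ => z + t • w := by fun_prop
    simpa using (this.tendsto 0).mono_left nhdsWithin_le_nhds
  have h2 : Filter.Tendsto (fun t : ℝ => z - t • w) (nhdsWithin 0 (Set.Ioi 0)) (nhds z) := by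
    have : Continuous fun t : ℝ => z - t • w := by fun_prop
    simpa using (this.tendsto 0).mono_left nhdsWithin_le_nhds
  have hA : A ∈ nhds z := mem_interior_iff_mem_nhds.1 hz
  obtain ⟨t, ⟨ht1, ht2⟩, ht⟩ :=
    (((h1.eventually hA).and (h2.eventually hA)).and self_mem_nhdsWithin).exists
  exact ⟨t, ht, ht1, ht2⟩

theorem lt_of_mem_interior {z : Plane} (hz : z ∈ interior R.carrier) :
    (0 < inner ℝ R.u (z - R.corner) ∧ inner ℝ R.u (z - R.corner) < inner ℝ R.u R.u) ∧
      (0 < inner ℝ R.v (z - R.corner) ∧ inner ℝ R.v (z - R.corner) < inner ℝ R.v R.v) := by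
  have hu := R.inner_u_pos
  have hv := R.inner_v_pos
  have key : ∀ w : Plane, 0 < inner ℝ w w → (∀ x ∈ R.carrier, 0 ≤ inner ℝ w (x - R.corner) ∧
      inner ℝ w (x - R.corner) ≤ inner ℝ w w) →
      0 < inner ℝ w (z - R.corner) ∧ inner ℝ w (z - R.corner) < inner ℝ w w := by
    intro w hw h
    obtain ⟨t, ht, h1, h2⟩ := exists_add_smul_mem_of_mem_interior hz w
    have h1 := (h _ h1).2
    have h2 := (h _ h2).1
    rw [add_sub_right_comm, inner_add_right, inner_smul_right] at h1
    rw [sub_right_comm, inner_sub_right, inner_smul_right] at h2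
    have := mul_pos ht hw
    constructor <;> linarith
  exact ⟨key _ hu fun x hx => ((R.mem_carrier_iff x).1 hx).1,
    key _ hv fun x hx => ((R.mem_carrier_iff x).1 hx).2⟩

theorem norm_u_pos : 0 < ‖R.u‖ := norm_pos_iff.2 R.u_ne_zero

theorem norm_v_pos : 0 < ‖R.v‖ := norm_pos_iff.2 R.v_ne_zero

theorem HasRatio.pos {R : PlaneRectangle} {r : ℝ} (h : R.HasRatio r) : 0 < r := by
  have hu := R.norm_u_pos
  have hv := R.norm_v_pos
  rcases h with h | h
  · exact pos_of_mul_pos_left (h ▸ hu) hv.le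
  · exact pos_of_mul_pos_left (h ▸ hv) hu.le

/-- The same rectangle with the roles of the two sides exchanged. -/
@[simps] def swap : PlaneRectangle where
  corner := R.corner
  u := R.v
  v := R.u
  u_ne_zero := R.v_ne_zero
  v_ne_zero := R.u_ne_zero
  orthogonal := R.inner_v_u

theorem swap_carrier : R.swap.carrier = R.carrier := by
  ext z
  rw [mem_carrier_iff, mem_carrier_iff, and_comm]
  rfl

/-- The rectangle with corner `c` whose side vectors are those of `R` multiplied by the positive
factors `s` and `t`. -/
@[simps] def resize (c : Plane) {s t : ℝ} (hs : 0 < s) (ht : 0 < t) : PlaneRectangle where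
  corner := c
  u := s • R.u
  v := t • R.v
  u_ne_zero := smul_ne_zero hs.ne' R.u_ne_zero
  v_ne_zero := smul_ne_zero ht.ne' R.v_ne_zero
  orthogonal := by rw [inner_smul_left, inner_smul_right, R.orthogonal]; simp

theorem swap_resize_carrier (c : Plane) {s t : ℝ} (hs : 0 < s) (ht : 0 < t) :
    (R.swap.resize c ht hs).carrier = (R.resize c hs ht).carrier :=
  (R.resize c hs ht).swap_carrier

end PlaneRectangle

/-! ### Composing dissections -/

/-- Dissections of the tiles refine a dissection. -/
theorem IsDissection.canBeCutIntoSimilar {M : Set Plane} {n : ℕ} {T : Fin n → PlaneRectangle}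
    (h : IsDissection M T) {r : ℝ} (hT : ∀ i, CanBeCutIntoSimilar (T i).carrier r) :
    CanBeCutIntoSimilar M r := by
  choose k S hS hr using hT
  let E := Fintype.equivFin (Σ i, Fin (k i))
  refine ⟨_, fun j => S (E.symm j).1 (E.symm j).2, ⟨?_, ?_⟩, fun j => hr _ _⟩
  · rw [E.symm.surjective.iUnion_comp (fun x : Σ i, Fin (k i) => (S x.1 x.2).carrier),
      Set.iUnion_sigma, ← h.1]
    exact Set.iUnion_congr fun i => (hS i).1
  · intro i j hij
    have hij' := E.symm.injective.ne hij
    change Disjoint (interior (S (E.symm i).1 (E.symm i).2).carrier)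
      (interior (S (E.symm j).1 (E.symm j).2).carrier)
    revert hij'
    generalize E.symm i = x
    generalize E.symm j = y
    obtain ⟨i, a⟩ := x
    obtain ⟨j, b⟩ := y
    intro hij'
    by_cases hc : i = j
    · subst hc
      exact (hS i).2 a b fun hab => hij' (by rw [hab])
    · have hsub : ∀ i a, interior (S i a).carrier ⊆ interior (T i).carrier := fun i a =>
        interior_mono (by rw [← (hS i).1]; exact Set.subset_iUnion (fun a => (S i a).carrier) a)
      exact (h.2 i j hc).mono (hsub i a) (hsub j b)

theorem PlaneRectangle.canBeCutIntoSimilar_of_hasRatio (R : PlaneRectangle) {r : ℝ}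
    (h : R.HasRatio r) : CanBeCutIntoSimilar R.carrier r := by
  refine ⟨1, fun _ => R, ⟨?_, ?_⟩, fun _ => h⟩
  · exact Set.iUnion_const _
  · intro i j hij
    exact absurd (Subsingleton.elim i j) hij

namespace PlaneRectangle

variable (R : PlaneRectangle) {r : ℝ}

/-- Two rectangles put side by side. -/
theorem canBeCutIntoSimilar_resize_add {c : Plane} {s s' t : ℝ} (hs : 0 < s) (hs' : 0 < s')
    (ht : 0 < t) (h : CanBeCutIntoSimilar (R.resize c hs ht).carrier r)
    (h' : CanBeCutIntoSimilar (R.resize (c + s • R.u) hs' ht).carrier r) :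
    CanBeCutIntoSimilar (R.resize c (add_pos hs hs') ht).carrier r := by
  have hu := R.inner_u_pos
  have hd : IsDissection (R.resize c (add_pos hs hs') ht).carrier
      ![R.resize c hs ht, R.resize (c + s • R.u) hs' ht] := by
    constructor
    · ext z
      simp only [Set.mem_iUnion, Fin.exists_fin_two, Matrix.cons_val_zero, Matrix.cons_val_one]
      simp only [mem_carrier_iff, resize_corner, resize_u, resize_v, ← sub_sub, inner_smul_left,
        inner_smul_right, inner_sub_right _ _ (_ • R.u), R.inner_v_u, conj_trivial, mul_zero,
        sub_zero]
      generalize inner ℝ R.u (z - c) = X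
      generalize inner ℝ R.v (z - c) = Y
      generalize inner ℝ R.u R.u = U at *
      rw [mul_left_comm s s' U, ← mul_sub s' X (s * U)]
      simp only [mul_nonneg_iff_of_pos_left, hs, hs', ht, add_pos, mul_le_mul_iff_right₀]
      have h1 := mul_pos hs hu
      have h2 := mul_pos hs' hu
      constructor
      · rintro (⟨⟨h1, h2⟩, h3⟩ | ⟨⟨h1, h2⟩, h3⟩)
        · exact ⟨⟨h1, by linarith⟩, h3⟩
        · exact ⟨⟨by linarith, by linarith⟩, h3⟩
      · rintro ⟨⟨h1, h2⟩, h3⟩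
        by_cases hX : X ≤ s * U
        · exact Or.inl ⟨⟨h1, hX⟩, h3⟩
        · exact Or.inr ⟨⟨by linarith, by linarith⟩, h3⟩
    · have key : Disjoint (interior (R.resize c hs ht).carrier)
          (interior (R.resize (c + s • R.u) hs' ht).carrier) := by
        rw [Set.disjoint_left]
        intro z h1 h2
        have h1 := (lt_of_mem_interior _ h1).1.2
        have h2 := (lt_of_mem_interior _ h2).1.1
        simp only [resize_corner, resize_u, ← sub_sub, inner_smul_left, inner_smul_right,
          inner_sub_right _ _ (_ • R.u), conj_trivial] at h1 h2
        have h1' := lt_of_mul_lt_mul_left h1 hs.le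
        rw [mul_left_comm, ← mul_sub] at h2
        have h2' := pos_of_mul_pos_right h2 hs'.le
        linarith
      intro i j hij
      fin_cases i <;> fin_cases j
      · exact absurd rfl hij
      · exact key
      · exact key.symm
      · exact absurd rfl hij
  refine hd.canBeCutIntoSimilar fun i => ?_
  fin_cases i
  · exact h
  · exact h'

theorem canBeCutIntoSimilar_congr {R R' : PlaneRectangle} (h : CanBeCutIntoSimilar R.carrier r)
    (hc : R.corner = R'.corner) (hu : R.u = R'.u) (hv : R.v = R'.v) :
    CanBeCutIntoSimilar R'.carrier r := by
  have : R.carrier = R'.carrier := by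
    rw [carrier, carrier, hc, hu, hv]
  rwa [← this]

theorem canBeCutIntoSimilar_resize_nat_mul {s t : ℝ} (hs : 0 < s) (ht : 0 < t)
    (h : ∀ c, CanBeCutIntoSimilar (R.resize c hs ht).carrier r) {k : ℕ} (hk : 0 < k) (c : Plane) :
    CanBeCutIntoSimilar (R.resize c (s := k * s) (by positivity) ht).carrier r := by
  induction k, hk using Nat.le_induction generalizing c with
  | base => exact canBeCutIntoSimilar_congr (h c) rfl (by simp) rfl
  | succ k hk ih =>
    have hk' : (0 : ℝ) < k * s := by
      have : (0 : ℝ) < k := by exact_mod_cast hk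
      positivity
    refine canBeCutIntoSimilar_congr
      (R.canBeCutIntoSimilar_resize_add hk' hs ht (ih c) (h _)) rfl ?_ rfl
    simp [add_mul]

/-- A rectangle whose side ratio is a positive rational multiple of `r` is cut by a grid. -/
theorem canBeCutIntoSimilar_of_rat_mul {q : ℚ} (hq : 0 < q) (h : ‖R.u‖ = q * r * ‖R.v‖) :
    CanBeCutIntoSimilar R.carrier r := by
  obtain ⟨m, n, hm, hn, rfl⟩ : ∃ m n : ℕ, 0 < m ∧ 0 < n ∧ q = m / n :=
    ⟨q.num.toNat, q.den, by have := Rat.num_pos.2 hq; omega, q.pos, by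
      have : ((q.num.toNat : ℤ) : ℚ) = q.num := by
        rw [Int.toNat_of_nonneg (Rat.num_pos.2 hq).le]
      rw [Int.cast_natCast] at this
      rw [this, Rat.num_div_den]⟩
  have hm' : (0 : ℝ) < m := by exact_mod_cast hm
  have hn' : (0 : ℝ) < n := by exact_mod_cast hn
  have hs : 0 < 1 / (m : ℝ) := by positivity
  have ht : 0 < 1 / (n : ℝ) := by positivity
  have cell : ∀ c, CanBeCutIntoSimilar (R.resize c hs ht).carrier r := by
    intro c
    refine canBeCutIntoSimilar_of_hasRatio _ (Or.inl ?_)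
    rw [resize_u, resize_v, norm_smul, norm_smul, h, Real.norm_of_nonneg hs.le,
      Real.norm_of_nonneg ht.le]
    push_cast
    field_simp
  have column := fun c => R.canBeCutIntoSimilar_resize_nat_mul hs ht cell hm c
  have hms : 0 < (m : ℝ) * (1 / m) := by positivity
  have := R.swap.canBeCutIntoSimilar_resize_nat_mul ht hms
    (fun c => by rw [swap_resize_carrier]; exact column c) hn R.corner
  rw [swap_resize_carrier] at this
  refine canBeCutIntoSimilar_congr this rfl ?_ ?_
  · rw [resize_u, mul_one_div_cancel hm'.ne', one_smul]
  · rw [resize_v, mul_one_div_cancel hn'.ne', one_smul]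

end PlaneRectangle

/-- The arithmetic criterion: `y` is a combination of `x` and `1 / x` with nonnegative rational
coefficients. For `x` and `y` in a real quadratic field it characterizes the side ratios `y` of the
rectangles that can be cut into rectangles with side ratio `x`. -/
def IsConicCombination (x y : ℝ) : Prop :=
  ∃ q q' : ℚ, 0 ≤ q ∧ 0 ≤ q' ∧ y = q * x + q' * x⁻¹

theorem IsConicCombination.canBeCutIntoSimilar {x y : ℝ} (h : IsConicCombination x y) (hx : 0 < x)
    {R : PlaneRectangle} (hR : R.HasRatio y) : CanBeCutIntoSimilar R.carrier x := by
  wlog hR' : ‖R.u‖ = y * ‖R.v‖ generalizing R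
  · rw [← R.swap_carrier]
    have hR'' := hR.resolve_left hR'
    exact this (Or.inl hR'') hR''
  obtain ⟨q, q', hq, hq', hy⟩ := h
  have hv := R.norm_v_pos
  have hu := R.norm_u_pos
  have hy0 := hR.pos
  rcases hq.eq_or_lt with rfl | hq
  · rcases hq'.eq_or_lt with rfl | hq'
    · simp at hy
      exact absurd hy hy0.ne'
    · rw [← R.swap_carrier]
      refine R.swap.canBeCutIntoSimilar_of_rat_mul (q := q'⁻¹) (by positivity) ?_
      have hq'' : (0 : ℝ) < q' := by exact_mod_cast hq'
      rw [PlaneRectangle.swap_u, PlaneRectangle.swap_v, hR', hy]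
      push_cast
      field_simp
      simp
  rcases hq'.eq_or_lt with rfl | hq'
  · refine R.canBeCutIntoSimilar_of_rat_mul hq ?_
    rw [hR', hy]
    simp
  have h1 : (0 : ℝ) < q := by exact_mod_cast hq
  have h2 : (0 : ℝ) < q' := by exact_mod_cast hq'
  -- A vertical line cuts `R` into rectangles with side ratios `q * x` and `q' / x`.
  have hs : 0 < q * x / y := by positivity
  have hs' : 0 < q' * x⁻¹ / y := by positivity
  refine PlaneRectangle.canBeCutIntoSimilar_congr
    (R.canBeCutIntoSimilar_resize_add (c := R.corner) hs hs' one_pos ?_ ?_) rfl ?_ ?_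
  · refine PlaneRectangle.canBeCutIntoSimilar_of_rat_mul _ hq ?_
    rw [PlaneRectangle.resize_u, PlaneRectangle.resize_v, norm_smul, norm_smul,
      Real.norm_of_nonneg hs.le, norm_one, hR']
    field_simp
  · rw [← PlaneRectangle.swap_carrier]
    refine PlaneRectangle.canBeCutIntoSimilar_of_rat_mul _ (q := q'⁻¹) (by positivity) ?_
    rw [PlaneRectangle.swap_u, PlaneRectangle.swap_v, PlaneRectangle.resize_u,
      PlaneRectangle.resize_v, norm_smul, norm_smul, Real.norm_of_nonneg hs'.le, norm_one, hR']
    push_cast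
    field_simp
  · rw [PlaneRectangle.resize_u, ← add_div, ← hy, div_self hy0.ne', one_smul]
  · rw [PlaneRectangle.resize_v, one_smul]

section Germs

open Filter Topology

/-! ### Orthonormal frames -/

/-- The vectors `e` and `n` form an orthonormal basis of the plane. -/
structure IsFrame (e n : Plane) : Prop where
  inner_left : inner ℝ e e = 1
  inner_right : inner ℝ n n = 1
  orthogonal : inner ℝ e n = 0

namespace IsFrame

variable {e n : Plane} (h : IsFrame e n)
include h

theorem orthogonal' : inner ℝ n e = 0 := by
  rw [real_inner_comm]; exact h.orthogonal

theorem swap : IsFrame n e := ⟨h.inner_right, h.inner_left, h.orthogonal'⟩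

theorem neg_left : IsFrame (-e) n :=
  ⟨by rw [inner_neg_neg, h.inner_left], h.inner_right, by simp [h.orthogonal]⟩

theorem neg_right : IsFrame e (-n) :=
  h.swap.neg_left.swap

theorem left_ne_zero : e ≠ 0 := by
  rintro rfl; simpa using h.inner_left

theorem right_ne_zero : n ≠ 0 := h.swap.left_ne_zero

theorem ext {z w : Plane} (h1 : inner ℝ e z = inner ℝ e w) (h2 : inner ℝ n z = inner ℝ n w) :
    z = w := by
  rw [← sub_eq_zero]
  apply Plane.eq_zero_of_inner_eq_zero h.left_ne_zero h.right_ne_zero h.orthogonal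
  · rw [inner_sub_right, h1, sub_self]
  · rw [inner_sub_right, h2, sub_self]

theorem inner_left_comb (x y : ℝ) : inner ℝ e (x • e + y • n) = x := by
  rw [inner_add_right, inner_smul_right, inner_smul_right, h.inner_left, h.orthogonal]; simp

theorem inner_right_comb (x y : ℝ) : inner ℝ n (x • e + y • n) = y := by
  rw [inner_add_right, inner_smul_right, inner_smul_right, h.inner_right, h.orthogonal']; simp

theorem comb_eq (z : Plane) : inner ℝ e z • e + inner ℝ n z • n = z :=
  h.ext (h.inner_left_comb _ _) (h.inner_right_comb _ _)

theorem inner_ne_zero {w : Plane} (hw : w ≠ 0) : inner ℝ w e ≠ 0 ∨ inner ℝ w n ≠ 0 := by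
  by_contra! hc
  refine hw (Plane.eq_zero_of_inner_eq_zero h.left_ne_zero h.right_ne_zero h.orthogonal ?_ ?_)
  · rw [real_inner_comm]; exact hc.1
  · rw [real_inner_comm]; exact hc.2

end IsFrame

theorem IsFrame.norm_left {e n : Plane} (hf : IsFrame e n) : ‖e‖ = 1 := by
  have := hf.inner_left
  rw [real_inner_self_eq_norm_sq] at this
  exact (pow_eq_one_iff_of_nonneg (norm_nonneg e) two_ne_zero).1 this

theorem IsFrame.norm_right {e n : Plane} (hf : IsFrame e n) : ‖n‖ = 1 := hf.swap.norm_left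

/-! ### Germs of the plane along parabolic arcs -/

/-- Positivity of the polynomial `p + α t + β t²` for all small `t > 0`. -/
def LexPos (p α β : ℝ) : Prop :=
  0 < p ∨ p = 0 ∧ (0 < α ∨ α = 0 ∧ 0 < β)

theorem LexPos.eventually {p α β : ℝ} (h : LexPos p α β) :
    ∀ᶠ t in 𝓝[>] (0 : ℝ), 0 < p + t * α + t ^ 2 * β := by
  rcases h with h | ⟨rfl, h | ⟨rfl, h⟩⟩
  · have : Tendsto (fun t : ℝ => p + t * α + t ^ 2 * β) (𝓝 0) (𝓝 p) := by
      have h1 : Continuous fun t : ℝ => p + t * α + t ^ 2 * β := by fun_prop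
      simpa using h1.tendsto 0
    exact (this.eventually_const_lt h).filter_mono nhdsWithin_le_nhds
  · have : Tendsto (fun t : ℝ => α + t * β) (𝓝 0) (𝓝 α) := by
      have h1 : Continuous fun t : ℝ => α + t * β := by fun_prop
      simpa using h1.tendsto 0
    filter_upwards [(this.eventually_const_lt h).filter_mono nhdsWithin_le_nhds,
      self_mem_nhdsWithin] with t ht ht0
    have := mul_pos (Set.mem_Ioi.1 ht0) ht
    linarith
  · filter_upwards [self_mem_nhdsWithin] with t ht0
    have : 0 < t := ht0
    positivity

/-- Unless `α = β = 0`, the polynomial `p + α t + β t²` has a sign for small `t > 0`. -/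
theorem lexPos_neg_of_not {p α β : ℝ} (h : ¬ LexPos p α β) (h0 : α ≠ 0 ∨ β ≠ 0) :
    LexPos (-p) (-α) (-β) := by
  simp only [LexPos, not_or, not_and, not_lt, neg_eq_zero, Left.neg_pos_iff] at *
  rcases h.1.lt_or_eq with h1 | h1
  · exact Or.inl h1
  · refine Or.inr ⟨h1, ?_⟩
    rcases (h.2 h1).1.lt_or_eq with h2 | h2
    · exact Or.inl h2
    · exact Or.inr ⟨h2, lt_of_le_of_ne ((h.2 h1).2 h2) (h0.resolve_left (by simp [h2]))⟩

theorem lexPos_congr_of_ne_zero {p α β β' : ℝ} (hα : α ≠ 0) : LexPos p α β ↔ LexPos p α β' := by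
  simp [LexPos, hα]

/-- The lexicographic sign does not change under a small translation of the arc forward along
its tangent. -/
theorem LexPos.eventually_add_mul_iff (p α β : ℝ) :
    ∀ᶠ x in 𝓝[>] (0 : ℝ), (LexPos (p + x * α) α β ↔ LexPos p α β) := by
  have hc : Tendsto (fun x : ℝ => p + x * α) (𝓝[>] 0) (𝓝 p) := by
    have h1 : Continuous fun x : ℝ => p + x * α := by fun_prop
    simpa using (h1.tendsto 0).mono_left nhdsWithin_le_nhds
  rcases lt_trichotomy p 0 with hp | rfl | hp
  · filter_upwards [hc.eventually_lt_const hp] with x hx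
    simp [LexPos, hx.not_gt, hx.ne, hp.not_gt, hp.ne]
  · filter_upwards [self_mem_nhdsWithin] with x hx
    have hx : 0 < x := hx
    rcases lt_trichotomy α 0 with hα | rfl | hα
    · have : x * α < 0 := mul_neg_of_pos_of_neg hx hα
      simp [LexPos, hα.not_gt, hα.ne, this.not_gt, hx.ne']
    · simp [LexPos]
    · simp [LexPos, hα, mul_pos hx hα]
  · filter_upwards [hc.eventually_const_lt hp] with x hx
    simp [LexPos, hx, hp]

theorem Ultrafilter.inter_mem_iff {α : Type*} {l : Ultrafilter α} {s t : Set α} :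
    s ∩ t ∈ l ↔ s ∈ l ∧ t ∈ l := Filter.inter_mem_iff

/-- An ultrafilter on the line that contains all right neighbourhoods of `0`. It decides every set,
which spares a discussion of limits. -/
noncomputable def rightUltrafilter : Ultrafilter ℝ := Ultrafilter.of (𝓝[>] (0 : ℝ))

/-- The germ at `P` of the parabolic arc `P + t e + t² n`, `t > 0`: it leaves `P` in the direction
of `e`, on the side of `n`. -/
noncomputable def arcGerm (P e n : Plane) : Ultrafilter Plane :=
  rightUltrafilter.map fun t => P + t • e + t ^ 2 • n

theorem mem_arcGerm_of_eventually {A : Set Plane} {P e n : Plane}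
    (h : ∀ᶠ t in 𝓝[>] (0 : ℝ), P + t • e + t ^ 2 • n ∈ A) : A ∈ arcGerm P e n :=
  Ultrafilter.mem_map.2 (Ultrafilter.of_le _ h)

theorem inner_arc (w P e n : Plane) (t : ℝ) :
    inner ℝ w (P + t • e + t ^ 2 • n) =
      inner ℝ w P + t * inner ℝ w e + t ^ 2 * inner ℝ w n := by
  rw [inner_add_right, inner_add_right, inner_smul_right, inner_smul_right]

theorem halfPlane_mem_arcGerm {w P e n : Plane} {a : ℝ}
    (h : LexPos (inner ℝ w P - a) (inner ℝ w e) (inner ℝ w n)) :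
    {z | a < inner ℝ w z} ∈ arcGerm P e n := by
  refine mem_arcGerm_of_eventually (h.eventually.mono fun t ht => ?_)
  rw [Set.mem_ofPred_eq, inner_arc]
  linarith

theorem halfPlane_mem_arcGerm_iff {w P e n : Plane} (hf : IsFrame e n) (hw : w ≠ 0) {a : ℝ} :
    {z | a < inner ℝ w z} ∈ arcGerm P e n ↔
      LexPos (inner ℝ w P - a) (inner ℝ w e) (inner ℝ w n) := by
  refine ⟨fun h => ?_, halfPlane_mem_arcGerm⟩
  by_contra hc
  have h1 := lexPos_neg_of_not hc (hf.inner_ne_zero hw)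
  have h2 : {z | -a < inner ℝ (-w) z} ∈ arcGerm P e n := by
    apply halfPlane_mem_arcGerm
    simpa [inner_neg_left, neg_add_eq_sub] using h1
  obtain ⟨z, hz1, hz2⟩ := (arcGerm P e n).nonempty_of_mem (inter_mem h h2)
  simp only [Set.mem_ofPred_eq, inner_neg_left] at hz1 hz2
  linarith

theorem closedHalfPlane_mem_arcGerm_iff {w P e n : Plane} (hf : IsFrame e n) (hw : w ≠ 0) {a : ℝ} :
    {z | a ≤ inner ℝ w z} ∈ arcGerm P e n ↔
      LexPos (inner ℝ w P - a) (inner ℝ w e) (inner ℝ w n) := by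
  refine ⟨fun h => ?_, fun h =>
    mem_of_superset (halfPlane_mem_arcGerm h) fun z (hz : a < inner ℝ w z) => hz.le⟩
  by_contra hc
  have h1 := lexPos_neg_of_not hc (hf.inner_ne_zero hw)
  have h2 : {z | -a < inner ℝ (-w) z} ∈ arcGerm P e n := by
    apply halfPlane_mem_arcGerm
    simpa [inner_neg_left, neg_add_eq_sub] using h1
  obtain ⟨z, hz1, hz2⟩ := (arcGerm P e n).nonempty_of_mem (inter_mem h h2)
  simp only [Set.mem_ofPred_eq, inner_neg_left] at hz1 hz2
  linarith

namespace PlaneRectangle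

variable (R : PlaneRectangle) {P e n : Plane}

theorem carrier_eq_inter : R.carrier =
    ({z | inner ℝ R.u R.corner ≤ inner ℝ R.u z} ∩
      {z | -inner ℝ R.u R.corner - inner ℝ R.u R.u ≤ inner ℝ (-R.u) z}) ∩
    ({z | inner ℝ R.v R.corner ≤ inner ℝ R.v z} ∩
      {z | -inner ℝ R.v R.corner - inner ℝ R.v R.v ≤ inner ℝ (-R.v) z}) := by
  ext z
  rw [mem_carrier_iff]
  simp only [Set.mem_inter_iff, Set.mem_ofPred_eq, inner_sub_right, inner_neg_left, sub_nonneg]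
  refine and_congr (and_congr Iff.rfl ?_) (and_congr Iff.rfl ?_) <;>
    constructor <;> intro h <;> linarith

/-- The interior of a rectangle is cut out by strict inequalities. -/
theorem interior_carrier_eq_inter : interior R.carrier =
    ({z | inner ℝ R.u R.corner < inner ℝ R.u z} ∩
      {z | -inner ℝ R.u R.corner - inner ℝ R.u R.u < inner ℝ (-R.u) z}) ∩
    ({z | inner ℝ R.v R.corner < inner ℝ R.v z} ∩
      {z | -inner ℝ R.v R.corner - inner ℝ R.v R.v < inner ℝ (-R.v) z}) := by
  ext z
  rw [show z ∈ interior R.carrier ↔ _ from ⟨R.lt_of_mem_interior, R.mem_interior_of_lt⟩]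
  simp only [Set.mem_inter_iff, Set.mem_ofPred_eq, inner_sub_right, inner_neg_left, sub_pos]
  refine and_congr (and_congr Iff.rfl ?_) (and_congr Iff.rfl ?_) <;>
    constructor <;> intro h <;> linarith

theorem carrier_mem_arcGerm_iff (hf : IsFrame e n) : R.carrier ∈ arcGerm P e n ↔
    (LexPos (inner ℝ R.u P - inner ℝ R.u R.corner) (inner ℝ R.u e) (inner ℝ R.u n) ∧
      LexPos (inner ℝ (-R.u) P - (-inner ℝ R.u R.corner - inner ℝ R.u R.u)) (inner ℝ (-R.u) e)
        (inner ℝ (-R.u) n)) ∧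
    (LexPos (inner ℝ R.v P - inner ℝ R.v R.corner) (inner ℝ R.v e) (inner ℝ R.v n) ∧
      LexPos (inner ℝ (-R.v) P - (-inner ℝ R.v R.corner - inner ℝ R.v R.v)) (inner ℝ (-R.v) e)
        (inner ℝ (-R.v) n)) := by
  have hu := R.u_ne_zero
  have hv := R.v_ne_zero
  rw [carrier_eq_inter, Ultrafilter.inter_mem_iff,
    Ultrafilter.inter_mem_iff, Ultrafilter.inter_mem_iff,
    closedHalfPlane_mem_arcGerm_iff hf hu, closedHalfPlane_mem_arcGerm_iff hf (neg_ne_zero.2 hu),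
    closedHalfPlane_mem_arcGerm_iff hf hv, closedHalfPlane_mem_arcGerm_iff hf (neg_ne_zero.2 hv)]

/-- No germ stays on the boundary of a rectangle. -/
theorem interior_mem_arcGerm (hf : IsFrame e n) (h : R.carrier ∈ arcGerm P e n) :
    interior R.carrier ∈ arcGerm P e n := by
  have hu := R.u_ne_zero
  have hv := R.v_ne_zero
  rw [interior_carrier_eq_inter, Ultrafilter.inter_mem_iff,
    Ultrafilter.inter_mem_iff, Ultrafilter.inter_mem_iff,
    halfPlane_mem_arcGerm_iff hf hu, halfPlane_mem_arcGerm_iff hf (neg_ne_zero.2 hu),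
    halfPlane_mem_arcGerm_iff hf hv, halfPlane_mem_arcGerm_iff hf (neg_ne_zero.2 hv)]
  exact (R.carrier_mem_arcGerm_iff hf).1 h

theorem eventually_mem_arcGerm_add_smul_iff (hf : IsFrame e n) : ∀ᶠ x in 𝓝[>] (0 : ℝ),
    (R.carrier ∈ arcGerm (P + x • e) e n ↔ R.carrier ∈ arcGerm P e n) := by
  simp only [R.carrier_mem_arcGerm_iff hf, inner_add_right, inner_smul_right, add_sub_right_comm]
  filter_upwards [LexPos.eventually_add_mul_iff (inner ℝ R.u P - inner ℝ R.u R.corner)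
      (inner ℝ R.u e) (inner ℝ R.u n),
    LexPos.eventually_add_mul_iff (inner ℝ (-R.u) P - (-inner ℝ R.u R.corner - inner ℝ R.u R.u))
      (inner ℝ (-R.u) e) (inner ℝ (-R.u) n),
    LexPos.eventually_add_mul_iff (inner ℝ R.v P - inner ℝ R.v R.corner)
      (inner ℝ R.v e) (inner ℝ R.v n),
    LexPos.eventually_add_mul_iff (inner ℝ (-R.v) P - (-inner ℝ R.v R.corner - inner ℝ R.v R.v))
      (inner ℝ (-R.v) e) (inner ℝ (-R.v) n)] with x h1 h2 h3 h4
  rw [h1, h2, h3, h4]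

end PlaneRectangle

theorem IsDissection.mem_arcGerm_iff {M : Set Plane} {k : ℕ} {T : Fin k → PlaneRectangle}
    (h : IsDissection M T) {P e n : Plane} :
    M ∈ arcGerm P e n ↔ ∃ i, (T i).carrier ∈ arcGerm P e n := by
  have := (arcGerm P e n).finite_biUnion_mem_iff (s := fun i => (T i).carrier)
    (Set.finite_univ (α := Fin k))
  simpa [h.1] using this

/-! ### Corner signs -/

/-- The indicator of "the set `A` contains the arc that leaves `P` in the direction of `e` on the
side of `n`". -/
noncomputable def arcIndicator (e n : Plane) (A : Set Plane) (P : Plane) : ℝ :=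
  open Classical in if A ∈ arcGerm P e n then 1 else 0

/-- The jump of the indicator function of `A`, from the side of `-n` to the side of `n`, across the
ray that starts at `P` in the direction of `e`. -/
noncomputable def jump (e n : Plane) (A : Set Plane) (P : Plane) : ℝ :=
  arcIndicator e n A P - arcIndicator e (-n) A P

/-- The change at `P` of the jump of the indicator function of `A` across the line through `P` in
the direction of `e`. At the corners of a rectangle with a side along `e` it is `±1`. -/
noncomputable def cornerSign (e n : Plane) (A : Set Plane) (P : Plane) : ℝ :=
  jump e n A P - jump (-e) n A P

theorem arcIndicator_congr {e n e' n' : Plane} {A A' : Set Plane} {P P' : Plane}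
    (h : A ∈ arcGerm P e n ↔ A' ∈ arcGerm P' e' n') :
    arcIndicator e n A P = arcIndicator e' n' A' P' := by
  by_cases hA : A ∈ arcGerm P e n
  · rw [arcIndicator, arcIndicator, if_pos hA, if_pos (h.1 hA)]
  · rw [arcIndicator, arcIndicator, if_neg hA, if_neg (fun hA' => hA (h.2 hA'))]

theorem IsDissection.arcIndicator_eq_sum {M : Set Plane} {k : ℕ} {T : Fin k → PlaneRectangle}
    (h : IsDissection M T) {e n : Plane} (hf : IsFrame e n) (P : Plane) :
    arcIndicator e n M P = ∑ i, arcIndicator e n (T i).carrier P := by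
  unfold arcIndicator
  by_cases hM : M ∈ arcGerm P e n
  · obtain ⟨i, hi⟩ := h.mem_arcGerm_iff.1 hM
    rw [if_pos hM, Finset.sum_eq_single i, if_pos hi]
    · intro j _ hji
      rw [if_neg]
      intro hj
      have := inter_mem ((T i).interior_mem_arcGerm hf hi) ((T j).interior_mem_arcGerm hf hj)
      rw [(h.2 i j hji.symm).inter_eq] at this
      exact (arcGerm P e n).empty_notMem this
    · simp
  · rw [if_neg hM, Finset.sum_eq_zero]
    intro i _
    rw [if_neg]
    exact fun hi => hM (h.mem_arcGerm_iff.2 ⟨i, hi⟩)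

theorem IsDissection.cornerSign_eq_sum {M : Set Plane} {k : ℕ} {T : Fin k → PlaneRectangle}
    (h : IsDissection M T) {e n : Plane} (hf : IsFrame e n) (P : Plane) :
    cornerSign e n M P = ∑ i, cornerSign e n (T i).carrier P := by
  simp only [cornerSign, jump, h.arcIndicator_eq_sum hf, h.arcIndicator_eq_sum hf.neg_left,
    h.arcIndicator_eq_sum hf.neg_right, h.arcIndicator_eq_sum hf.neg_left.neg_right,
    Finset.sum_sub_distrib]

/-- In the coordinates of the frame `(e, n)` the set `A` is the box `[x₁, x₂] × [y₁, y₂]`. -/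
structure IsBox (e n : Plane) (A : Set Plane) (x₁ x₂ y₁ y₂ : ℝ) : Prop where
  hx : x₁ < x₂
  hy : y₁ < y₂
  mem_iff : ∀ z, z ∈ A ↔ (x₁ ≤ inner ℝ e z ∧ inner ℝ e z ≤ x₂) ∧
    (y₁ ≤ inner ℝ n z ∧ inner ℝ n z ≤ y₂)

namespace IsBox

variable {e n : Plane} {A : Set Plane} {x₁ x₂ y₁ y₂ : ℝ}

theorem swap (h : IsBox e n A x₁ x₂ y₁ y₂) : IsBox n e A y₁ y₂ x₁ x₂ :=
  ⟨h.hy, h.hx, fun z => by rw [h.mem_iff, and_comm]⟩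

theorem neg_left (h : IsBox e n A x₁ x₂ y₁ y₂) : IsBox (-e) n A (-x₂) (-x₁) y₁ y₂ :=
  ⟨neg_lt_neg h.hx, h.hy, fun z => by
    rw [h.mem_iff, inner_neg_left, neg_le_neg_iff, neg_le_neg_iff, and_comm (a := x₁ ≤ _)]⟩

theorem neg_right (h : IsBox e n A x₁ x₂ y₁ y₂) : IsBox e (-n) A x₁ x₂ (-y₂) (-y₁) :=
  h.swap.neg_left.swap

theorem mem_arcGerm_iff (h : IsBox e n A x₁ x₂ y₁ y₂) (hf : IsFrame e n) (P : Plane) :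
    A ∈ arcGerm P e n ↔ (x₁ ≤ inner ℝ e P ∧ inner ℝ e P < x₂) ∧
      (y₁ ≤ inner ℝ n P ∧ inner ℝ n P < y₂) := by
  have hA : A = ({z | x₁ ≤ inner ℝ e z} ∩ {z | -x₂ ≤ inner ℝ (-e) z}) ∩
      ({z | y₁ ≤ inner ℝ n z} ∩ {z | -y₂ ≤ inner ℝ (-n) z}) := by
    ext z
    simp only [h.mem_iff, Set.mem_inter_iff, Set.mem_ofPred_eq, inner_neg_left, neg_le_neg_iff]
  have he := hf.left_ne_zero
  have hn := hf.right_ne_zero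
  rw [hA, Ultrafilter.inter_mem_iff,
    Ultrafilter.inter_mem_iff, Ultrafilter.inter_mem_iff,
    closedHalfPlane_mem_arcGerm_iff hf he, closedHalfPlane_mem_arcGerm_iff hf (neg_ne_zero.2 he),
    closedHalfPlane_mem_arcGerm_iff hf hn, closedHalfPlane_mem_arcGerm_iff hf (neg_ne_zero.2 hn)]
  simp only [LexPos, inner_neg_left, hf.inner_left, hf.inner_right, hf.orthogonal,
    hf.orthogonal']
  norm_num
  refine and_congr (and_congr ?_ ?_) (and_congr ?_ ?_)
  · rw [le_iff_lt_or_eq, sub_eq_zero, eq_comm (a := x₁)]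
  · rfl
  · rw [le_iff_lt_or_eq, sub_eq_zero, eq_comm (a := y₁)]
  · rfl

/-- The corner sign of a box is `1` at two opposite corners, `-1` at the other two corners, and `0`
elsewhere. -/
theorem cornerSign_eq (h : IsBox e n A x₁ x₂ y₁ y₂) (hf : IsFrame e n) (P : Plane) :
    cornerSign e n A P =
      ((if inner ℝ e P = x₁ then 1 else 0) - (if inner ℝ e P = x₂ then 1 else 0)) *
        ((if inner ℝ n P = y₁ then 1 else 0) - (if inner ℝ n P = y₂ then 1 else 0)) := by
  have hx := h.hx
  have hy := h.hy
  simp only [cornerSign, jump, arcIndicator, h.mem_arcGerm_iff hf,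
    h.neg_left.mem_arcGerm_iff hf.neg_left, h.neg_right.mem_arcGerm_iff hf.neg_right,
    h.neg_left.neg_right.mem_arcGerm_iff hf.neg_left.neg_right, inner_neg_left, neg_le_neg_iff,
    neg_lt_neg_iff]
  generalize inner ℝ e P = x
  generalize inner ℝ n P = y
  have key : ∀ {a b z : ℝ}, a < b → ((if a ≤ z ∧ z < b then (1 : ℝ) else 0) -
      (if z ≤ b ∧ a < z then 1 else 0)) = (if z = a then 1 else 0) - (if z = b then 1 else 0) := by
    intro a b z hab
    rcases lt_trichotomy z a with h1 | rfl | h1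
    · simp [h1.not_ge, h1.ne, (h1.trans hab).ne, h1.not_gt]
    · simp [hab, hab.ne]
    · rcases lt_trichotomy z b with h2 | rfl | h2
      · simp [h1, h1.le, h2, h2.le, h1.ne', h2.ne]
      · simp [h1, h1.ne']
      · simp [h2.not_ge, h2.not_gt, h1.ne', h2.ne']
  rw [← key hx, ← key hy]
  have ite_mul_ite : ∀ (p q : Prop) [Decidable p] [Decidable q],
      (if p ∧ q then (1 : ℝ) else 0) = (if p then 1 else 0) * (if q then 1 else 0) := by
    intro p q _ _
    by_cases hp : p <;> by_cases hq : q <;> simp [hp, hq]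
  simp only [ite_mul_ite (_ ∧ _) (_ ∧ _)]
  ring

end IsBox

/-- The sum over the corners `P` of `A` of `± f (x(P)) g (y(P))`, in the coordinates of the frame
`(e, n)`. For a set that can be cut into rectangles only finitely many corner signs are nonzero. -/
noncomputable def cornerSum (e n : Plane) (f g : ℝ →+ ℝ) (A : Set Plane) : ℝ :=
  ∑ᶠ P, cornerSign e n A P * (f (inner ℝ e P) * g (inner ℝ n P))

namespace IsBox

variable {e n : Plane} {A : Set Plane} {x₁ x₂ y₁ y₂ : ℝ}

theorem support_cornerSign_subset (h : IsBox e n A x₁ x₂ y₁ y₂) (hf : IsFrame e n) :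
    Function.support (cornerSign e n A) ⊆
      (fun q : ℝ × ℝ => q.1 • e + q.2 • n) '' (({x₁, x₂} ×ˢ {y₁, y₂} : Finset (ℝ × ℝ)) :
        Set (ℝ × ℝ)) := by
  intro P hP
  rw [Function.mem_support, h.cornerSign_eq hf] at hP
  refine ⟨(inner ℝ e P, inner ℝ n P), ?_, hf.comb_eq P⟩
  have h1 := left_ne_zero_of_mul hP
  have h2 := right_ne_zero_of_mul hP
  simp only [Finset.coe_product, Set.mem_prod, Finset.coe_insert, Finset.coe_singleton,
    Set.mem_insert_iff, Set.mem_singleton_iff]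
  constructor
  · by_contra! hc
    simp [hc] at h1
  · by_contra! hc
    simp [hc] at h2

theorem cornerSum_eq (h : IsBox e n A x₁ x₂ y₁ y₂) (hf : IsFrame e n) (f g : ℝ →+ ℝ) :
    cornerSum e n f g A = f (x₂ - x₁) * g (y₂ - y₁) := by
  classical
  have hinj : Function.Injective (fun q : ℝ × ℝ => q.1 • e + q.2 • n) := by
    intro q q' hq
    simp only at hq
    ext
    · simpa [hf.inner_left_comb] using congrArg (inner ℝ e) hq
    · simpa [hf.inner_right_comb] using congrArg (inner ℝ n) hq
  have hx := h.hx
  have hy := h.hy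
  rw [cornerSum, finsum_eq_sum_of_support_subset (s := ({x₁, x₂} ×ˢ {y₁, y₂} : Finset (ℝ × ℝ)).image
    (fun q : ℝ × ℝ => q.1 • e + q.2 • n))]
  · rw [Finset.sum_image hinj.injOn, Finset.sum_product]
    simp only [h.cornerSign_eq hf, hf.inner_left_comb, hf.inner_right_comb]
    rw [Finset.sum_pair hx.ne, Finset.sum_pair hy.ne, Finset.sum_pair hy.ne]
    simp only [hx.ne, hx.ne', hy.ne, hy.ne', if_true, if_false, map_sub]
    ring
  · rw [Finset.coe_image]
    refine Set.Subset.trans (fun P hP => ?_) (h.support_cornerSign_subset hf)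
    exact left_ne_zero_of_mul hP

end IsBox

/-! ### Rectangles aligned with a frame -/

namespace PlaneRectangle

variable (R : PlaneRectangle) {e n : Plane}

/-- The vectors parallel to a side of a rectangle: in the plane these are the vectors orthogonal to
one of the two side vectors. -/
def directions : Set Plane := {w | inner ℝ R.u w = 0 ∨ inner ℝ R.v w = 0}

theorem swap_directions : R.swap.directions = R.directions := by
  ext w
  exact or_comm

theorem exists_eq_smul_of_inner_eq_zero (hf : IsFrame e n) (h : inner ℝ R.v e = 0) :
    ∃ l m : ℝ, l ≠ 0 ∧ m ≠ 0 ∧ R.u = l • e ∧ R.v = m • n := by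
  have h' : inner ℝ e R.v = 0 := by rw [real_inner_comm]; exact h
  have hv : R.v = inner ℝ n R.v • n := by
    conv_lhs => rw [← hf.comb_eq R.v, h', zero_smul, zero_add]
  have hm : inner ℝ n R.v ≠ 0 := by
    intro hc
    rw [hc, zero_smul] at hv
    exact R.v_ne_zero hv
  have h2 : inner ℝ n R.u = 0 := by
    have h3 := R.orthogonal
    rw [real_inner_comm, hv, real_inner_smul_left] at h3
    exact (mul_eq_zero.1 h3).resolve_left hm
  have hu : R.u = inner ℝ e R.u • e := by
    conv_lhs => rw [← hf.comb_eq R.u, h2, zero_smul, add_zero]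
  refine ⟨_, _, ?_, hm, hu, hv⟩
  intro hc
  rw [hc, zero_smul] at hu
  exact R.u_ne_zero hu

/-- If one side direction of a rectangle belongs to a frame, then so do all of them. -/
theorem directions_eq_of_mem (hf : IsFrame e n) (h : e ∈ R.directions) :
    R.directions = {w | inner ℝ e w = 0 ∨ inner ℝ n w = 0} := by
  wlog hv : inner ℝ R.v e = 0 generalizing R
  · rw [← R.swap_directions]
    exact this R.swap (by rwa [R.swap_directions]) (h.resolve_right hv)
  obtain ⟨l, m, hl, hm, hu, hv⟩ := R.exists_eq_smul_of_inner_eq_zero hf hv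
  ext w
  simp [directions, hu, hv, real_inner_smul_left, hl, hm]

theorem mem_directions_swap (hf : IsFrame e n) (h : e ∈ R.directions) : n ∈ R.directions := by
  rw [R.directions_eq_of_mem hf h]
  exact Or.inl hf.orthogonal

theorem exists_isBox (hf : IsFrame e n) (h : e ∈ R.directions) :
    ∃ x₁ x₂ y₁ y₂ : ℝ, IsBox e n R.carrier x₁ x₂ y₁ y₂ ∧
      (x₂ - x₁ = ‖R.u‖ ∧ y₂ - y₁ = ‖R.v‖ ∨ x₂ - x₁ = ‖R.v‖ ∧ y₂ - y₁ = ‖R.u‖) := by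
  wlog hv : inner ℝ R.v e = 0 generalizing R
  · obtain ⟨x₁, x₂, y₁, y₂, h1, h2⟩ :=
      this R.swap (by rwa [R.swap_directions]) (h.resolve_right hv)
    rw [R.swap_carrier] at h1
    exact ⟨x₁, x₂, y₁, y₂, h1, h2.symm⟩
  obtain ⟨l, m, hl, hm, hu, hv⟩ := R.exists_eq_smul_of_inner_eq_zero hf hv
  have key : ∀ {l : ℝ}, l ≠ 0 → min 0 l < max 0 l ∧ max 0 l - min 0 l = |l| ∧
      ∀ c d, (0 ≤ l * (d - c) ∧ l * (d - c) ≤ l * (l * 1)) ↔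
        (c + min 0 l ≤ d ∧ d ≤ c + max 0 l) := by
    intro l hl
    rcases hl.lt_or_gt with h | h
    · rw [min_eq_right h.le, max_eq_left h.le, abs_of_neg h]
      refine ⟨h, by ring, fun c d => ?_⟩
      constructor
      · rintro ⟨h1, h2⟩
        constructor <;> nlinarith
      · rintro ⟨h1, h2⟩
        constructor <;> nlinarith
    · rw [min_eq_left h.le, max_eq_right h.le, abs_of_pos h]
      refine ⟨h, by ring, fun c d => ?_⟩
      constructor
      · rintro ⟨h1, h2⟩
        constructor <;> nlinarith
      · rintro ⟨h1, h2⟩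
        constructor <;> nlinarith
  obtain ⟨hl1, hl2, hl3⟩ := key hl
  obtain ⟨hm1, hm2, hm3⟩ := key hm
  refine ⟨inner ℝ e R.corner + min 0 l, inner ℝ e R.corner + max 0 l,
    inner ℝ n R.corner + min 0 m, inner ℝ n R.corner + max 0 m, ⟨?_, ?_, ?_⟩, Or.inl ⟨?_, ?_⟩⟩
  · linarith
  · linarith
  · intro z
    rw [mem_carrier_iff, hu, hv]
    simp only [real_inner_smul_left, inner_smul_right, hf.inner_left, hf.inner_right,
      inner_sub_right, ← mul_sub, hl3, hm3]
  · rw [hu, norm_smul, hf.norm_left, Real.norm_eq_abs]; linarith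
  · rw [hv, norm_smul, hf.norm_right, Real.norm_eq_abs]; linarith

/-- Near a line that is not parallel to a side, the indicator function of a rectangle does not jump
across that line. -/
theorem cornerSign_eq_zero (hf : IsFrame e n) (h : e ∉ R.directions) (P : Plane) :
    cornerSign e n R.carrier P = 0 := by
  simp only [directions, Set.mem_ofPred_eq, not_or] at h
  have key : ∀ e' : Plane, IsFrame e' n → inner ℝ R.u e' ≠ 0 → inner ℝ R.v e' ≠ 0 →
      jump e' n R.carrier P = 0 := by
    intro e' hf hu hv
    have hu' : inner ℝ (-R.u) e' ≠ 0 := by simpa using hu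
    have hv' : inner ℝ (-R.v) e' ≠ 0 := by simpa using hv
    rw [jump, sub_eq_zero]
    apply arcIndicator_congr
    rw [R.carrier_mem_arcGerm_iff hf, R.carrier_mem_arcGerm_iff hf.neg_right,
      lexPos_congr_of_ne_zero hu, lexPos_congr_of_ne_zero hu', lexPos_congr_of_ne_zero hv,
      lexPos_congr_of_ne_zero hv']
  rw [cornerSign, key e hf h.1 h.2, key (-e) hf.neg_left (by simpa using h.1) (by simpa using h.2),
    sub_zero]

theorem finite_support_cornerSign (hf : IsFrame e n) :
    (Function.support (cornerSign e n R.carrier)).Finite := by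
  by_cases h : e ∈ R.directions
  · obtain ⟨x₁, x₂, y₁, y₂, hb, -⟩ := R.exists_isBox hf h
    exact ((Finset.finite_toSet _).image _).subset (hb.support_cornerSign_subset hf)
  · have : cornerSign e n R.carrier = 0 := funext (R.cornerSign_eq_zero hf h)
    rw [this, Function.support_zero]
    exact Set.finite_empty

/-- The symmetrized product `f(a) g(b) + f(b) g(a)` of the side lengths `a` and `b`. -/
noncomputable def sideForm (f g : ℝ →+ ℝ) : ℝ := f ‖R.u‖ * g ‖R.v‖ + f ‖R.v‖ * g ‖R.u‖

/-- Exchanging the two vectors of the frame symmetrizes the product of the side lengths, which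
removes the distinction between horizontal and vertical sides. -/
theorem cornerSum_add_cornerSum (hf : IsFrame e n) (f g : ℝ →+ ℝ) :
    cornerSum e n f g R.carrier + cornerSum n e f g R.carrier =
      open Classical in if e ∈ R.directions then R.sideForm f g else 0 := by
  by_cases h : e ∈ R.directions
  · obtain ⟨x₁, x₂, y₁, y₂, hb, hs⟩ := R.exists_isBox hf h
    rw [hb.cornerSum_eq hf, hb.swap.cornerSum_eq hf.swap, if_pos h, sideForm]
    rcases hs with ⟨h1, h2⟩ | ⟨h1, h2⟩
    · rw [h1, h2]
    · rw [h1, h2, add_comm]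
  · have h' : n ∉ R.directions := fun hn => h (R.mem_directions_swap hf.swap hn)
    simp [cornerSum, R.cornerSign_eq_zero hf h, R.cornerSign_eq_zero hf.swap h', h]

theorem exists_isFrame : ∃ e n, IsFrame e n ∧ e ∈ R.directions := by
  have hu := R.norm_u_pos.ne'
  have hv := R.norm_v_pos.ne'
  refine ⟨‖R.u‖⁻¹ • R.u, ‖R.v‖⁻¹ • R.v, ⟨?_, ?_, ?_⟩, Or.inr ?_⟩
  · rw [real_inner_smul_left, inner_smul_right, real_inner_self_eq_norm_sq]
    field_simp
  · rw [real_inner_smul_left, inner_smul_right, real_inner_self_eq_norm_sq]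
    field_simp
  · rw [real_inner_smul_left, inner_smul_right, R.orthogonal]; simp
  · rw [inner_smul_right, R.inner_v_u, mul_zero]

end PlaneRectangle

theorem IsDissection.cornerSum_eq_sum {M : Set Plane} {k : ℕ} {T : Fin k → PlaneRectangle}
    (h : IsDissection M T) {e n : Plane} (hf : IsFrame e n) (f g : ℝ →+ ℝ) :
    cornerSum e n f g M = ∑ i, cornerSum e n f g (T i).carrier := by
  simp only [cornerSum, h.cornerSign_eq_sum hf, Finset.sum_mul]
  refine finsum_sum_comm _ _ fun i _ => ((T i).finite_support_cornerSign hf).subset fun P hP => ?_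
  exact left_ne_zero_of_mul hP

/-- The contribution of the tiles in a given position to the sum of the side forms is determined
by the corner sums of the dissected set. -/
theorem IsDissection.sum_sideForm_of_mem_directions {M : Set Plane} {k : ℕ}
    {T : Fin k → PlaneRectangle} (h : IsDissection M T) {e n : Plane} (hf : IsFrame e n)
    (f g : ℝ →+ ℝ) :
    ∑ i, (open Classical in if e ∈ (T i).directions then (T i).sideForm f g else 0) =
      cornerSum e n f g M + cornerSum n e f g M := by
  rw [h.cornerSum_eq_sum hf, h.cornerSum_eq_sum hf.swap, ← Finset.sum_add_distrib]
  exact Finset.sum_congr rfl fun i _ => ((T i).cornerSum_add_cornerSum hf f g).symm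

/-- The sum of the side forms of the tiles depends only on the corner sums of the dissected set. -/
theorem IsDissection.sum_sideForm_congr {M M' : Set Plane} {k k' : ℕ}
    {T : Fin k → PlaneRectangle} {T' : Fin k' → PlaneRectangle} (h : IsDissection M T)
    (h' : IsDissection M' T') (f g : ℝ →+ ℝ)
    (hM : ∀ e n, IsFrame e n → cornerSum e n f g M = cornerSum e n f g M') :
    ∑ i, (T i).sideForm f g = ∑ i, (T' i).sideForm f g := by
  classical
  let D : Finset (Set Plane) := Finset.univ.image (fun i => (T i).directions) ∪
    Finset.univ.image (fun i => (T' i).directions)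
  rw [← Finset.sum_fiberwise_of_maps_to (t := D) (g := fun i => (T i).directions)
      (fun i _ => Finset.mem_union_left _ (Finset.mem_image_of_mem _ (Finset.mem_univ i))),
    ← Finset.sum_fiberwise_of_maps_to (t := D) (g := fun i => (T' i).directions)
      (fun i _ => Finset.mem_union_right _ (Finset.mem_image_of_mem _ (Finset.mem_univ i)))]
  refine Finset.sum_congr rfl fun d hd => ?_
  obtain ⟨R, rfl⟩ : ∃ R : PlaneRectangle, R.directions = d := by
    rcases Finset.mem_union.1 hd with hd | hd
    · obtain ⟨i, -, hi⟩ := Finset.mem_image.1 hd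
      exact ⟨_, hi⟩
    · obtain ⟨i, -, hi⟩ := Finset.mem_image.1 hd
      exact ⟨_, hi⟩
  obtain ⟨e, n, hf, he⟩ := R.exists_isFrame
  -- A rectangle is in the position of `R` if and only if it is aligned with a frame of `R`.
  have hiff : ∀ T : PlaneRectangle, T.directions = R.directions ↔ e ∈ T.directions := by
    intro T
    constructor
    · intro hT
      rwa [hT]
    · intro hT
      rw [T.directions_eq_of_mem hf hT, R.directions_eq_of_mem hf he]
  simp only [Finset.sum_filter, hiff]
  have h1 := h.sum_sideForm_of_mem_directions hf f g
  have h2 := h'.sum_sideForm_of_mem_directions hf f g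
  rw [hM e n hf, hM n e hf.swap, ← h2] at h1
  convert h1

/-! ### Sets with polygonal frontier -/

/-- A connected set that misses the frontier of `M` lies on one side of it, so that germs contained
in it agree about `M`. -/
theorem mem_iff_mem_of_isPreconnected {C M : Set Plane} (hC : IsPreconnected C)
    (hd : Disjoint C (frontier M)) {l l' : Ultrafilter Plane} (hl : C ∈ l) (hl' : C ∈ l') :
    M ∈ l ↔ M ∈ l' := by
  have key : ∀ {l l' : Ultrafilter Plane}, C ∈ l → C ∈ l' → M ∈ l → M ∈ l' := by
    intro l l' hl hl' h
    refine mem_of_superset hl' ?_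
    by_contra hc
    obtain ⟨x, hx, hxM⟩ := Set.not_subset.1 hc
    obtain ⟨y, hy, hyM⟩ := l.nonempty_of_mem (inter_mem hl h)
    have hmem : ∀ z ∈ C, z ∈ closure M → z ∈ interior M := fun z hz hzc => by
      by_contra hzi
      exact Set.disjoint_left.1 hd hz ⟨hzc, hzi⟩
    obtain ⟨z, -, hz, hz'⟩ := hC (interior M) (closure M)ᶜ isOpen_interior
      isClosed_closure.isOpen_compl (fun z hz => by
        by_cases hzc : z ∈ closure M
        · exact Or.inl (hmem z hz hzc)
        · exact Or.inr hzc)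
      ⟨y, hy, hmem y hy (subset_closure hyM)⟩
      ⟨x, hx, fun hxc => hxM (interior_subset (hmem x hx hxc))⟩
    exact hz' (interior_subset_closure hz)
  exact ⟨key hl hl', key hl' hl⟩

theorem isLinearMap_inner (w : Plane) : IsLinearMap ℝ fun z : Plane => inner ℝ w z :=
  ⟨fun _ _ => inner_add_right _ _ _, fun _ _ => inner_smul_right _ _ _⟩

/-- The truncated cone with apex `P` and axis `e`. -/
def cone (P e n : Plane) (δ : ℝ) : Set Plane :=
  {z | inner ℝ e P < inner ℝ e z} ∩ {z | inner ℝ e z < inner ℝ e P + δ} ∩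
    ({z | inner ℝ (n - δ • e) z ≤ inner ℝ (n - δ • e) P} ∩
      {z | inner ℝ (-n - δ • e) z ≤ inner ℝ (-n - δ • e) P})

theorem mem_cone_iff {P e n z : Plane} {δ : ℝ} : z ∈ cone P e n δ ↔
    (0 < inner ℝ e (z - P) ∧ inner ℝ e (z - P) < δ) ∧
      |inner ℝ n (z - P)| ≤ δ * inner ℝ e (z - P) := by
  simp only [cone, Set.mem_inter_iff, Set.mem_ofPred_eq, inner_sub_left, inner_sub_right,
    inner_neg_left, real_inner_smul_left, abs_le]
  constructor
  · rintro ⟨⟨h1, h2⟩, h3, h4⟩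
    refine ⟨⟨?_, ?_⟩, ?_, ?_⟩ <;> linarith
  · rintro ⟨⟨h1, h2⟩, h3, h4⟩
    refine ⟨⟨?_, ?_⟩, ?_, ?_⟩ <;> linarith

theorem convex_cone (P e n : Plane) (δ : ℝ) : Convex ℝ (cone P e n δ) :=
  ((convex_halfSpace_gt (isLinearMap_inner e) _).inter
    (convex_halfSpace_lt (isLinearMap_inner e) _)).inter
  ((convex_halfSpace_le (isLinearMap_inner _) _).inter
    (convex_halfSpace_le (isLinearMap_inner _) _))

theorem cone_neg (P e n : Plane) (δ : ℝ) : cone P e (-n) δ = cone P e n δ := by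
  ext z
  rw [mem_cone_iff, mem_cone_iff, inner_neg_left, abs_neg]

theorem cone_mem_arcGerm {P e n : Plane} (hf : IsFrame e n) {δ : ℝ} (hδ : 0 < δ) :
    cone P e n δ ∈ arcGerm P e n := by
  apply mem_arcGerm_of_eventually
  filter_upwards [Ioo_mem_nhdsGT hδ] with t ht
  have hz : P + t • e + t ^ 2 • n - P = t • e + t ^ 2 • n := by abel
  rw [mem_cone_iff, hz, hf.inner_left_comb, hf.inner_right_comb, abs_of_nonneg (sq_nonneg t)]
  exact ⟨ht, by nlinarith [ht.1, ht.2]⟩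

theorem jump_eq_zero_of_disjoint_cone {M : Set Plane} {P e n : Plane} (hf : IsFrame e n) {δ : ℝ}
    (hδ : 0 < δ) (hd : Disjoint (cone P e n δ) (frontier M)) : jump e n M P = 0 := by
  rw [jump, sub_eq_zero]
  refine arcIndicator_congr (mem_iff_mem_of_isPreconnected (convex_cone P e n δ).isPreconnected hd
    (cone_mem_arcGerm hf hδ) ?_)
  rw [← cone_neg]
  exact cone_mem_arcGerm hf.neg_right hδ

theorem isClosed_segment (A B : Plane) : IsClosed (segment ℝ A B) := by
  rw [segment_eq_image_lineMap]
  exact (isCompact_Icc.image (by fun_prop)).isClosed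

/-- A segment that does not leave `P` in the direction of `e` misses a thin cone about this
direction. -/
theorem eventually_disjoint_cone_segment {P e n : Plane} (hf : IsFrame e n) {A B : Plane}
    (h : ∀ t > (0 : ℝ), P ∈ segment ℝ A B → P + t • e ∉ segment ℝ A B) :
    ∀ᶠ δ in 𝓝[>] (0 : ℝ), Disjoint (cone P e n δ) (segment ℝ A B) := by
  by_cases hP : P ∈ segment ℝ A B
  · obtain ⟨p, hp, hpP⟩ := by
      rw [segment_eq_image'] at hP
      exact hP
    -- Every point of the segment has the form `P + m • (B - A)`.
    have hseg : ∀ z ∈ segment ℝ A B, ∃ m : ℝ, z - P = m • (B - A) := by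
      intro z hz
      rw [segment_eq_image'] at hz
      obtain ⟨q, -, rfl⟩ := hz
      refine ⟨q - p, ?_⟩
      rw [← hpP]
      module
    by_cases hD : inner ℝ n (B - A) = 0
    · refine Eventually.of_forall fun δ => Set.disjoint_left.2 fun z hz hzs => ?_
      obtain ⟨m, hm⟩ := hseg z hzs
      have h1 := (mem_cone_iff.1 hz).1.1
      refine h _ h1 hP ?_
      convert hzs
      rw [add_comm, ← eq_sub_iff_add_eq]
      refine hf.ext ?_ ?_
      · rw [inner_smul_right, hf.inner_left, mul_one]
      · rw [inner_smul_right, hf.orthogonal', mul_zero, hm, inner_smul_right, hD, mul_zero]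
    · have hlim : Tendsto (fun δ : ℝ => δ * |inner ℝ e (B - A)|) (𝓝[>] 0) (𝓝 0) := by
        have : Continuous fun δ : ℝ => δ * |inner ℝ e (B - A)| := by fun_prop
        simpa using (this.tendsto 0).mono_left nhdsWithin_le_nhds
      filter_upwards [hlim.eventually_lt_const (abs_pos.2 hD), self_mem_nhdsWithin] with δ hδ hδ0
      refine Set.disjoint_left.2 fun z hz hzs => ?_
      obtain ⟨m, hm⟩ := hseg z hzs
      obtain ⟨⟨h1, -⟩, h2⟩ := mem_cone_iff.1 hz
      have h3 : inner ℝ e (z - P) = |inner ℝ e (z - P)| := (abs_of_pos h1).symm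
      rw [h3, hm, inner_smul_right, inner_smul_right, abs_mul, abs_mul] at h2
      have hm0 : 0 < |m| := by
        rw [abs_pos]
        rintro rfl
        simp [hm] at h1
      nlinarith
  · obtain ⟨r, hr, hball⟩ := Metric.isOpen_iff.1 (isClosed_segment A B).isOpen_compl P hP
    have h1 : Set.Ioo (0 : ℝ) (min 1 (r / 2)) ∈ 𝓝[>] (0 : ℝ) := Ioo_mem_nhdsGT (by positivity)
    filter_upwards [h1] with δ hδ
    refine Set.disjoint_left.2 fun z hz => hball ?_
    obtain ⟨⟨h1, h2⟩, h3⟩ := mem_cone_iff.1 hz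
    have hδ1 := hδ.2.trans_le (min_le_left _ _)
    have hδ2 := hδ.2.trans_le (min_le_right _ _)
    rw [Metric.mem_ball, dist_eq_norm, ← hf.comb_eq (z - P)]
    refine (norm_add_le _ _).trans_lt ?_
    rw [norm_smul, norm_smul, hf.norm_left, hf.norm_right, Real.norm_of_nonneg h1.le,
      Real.norm_eq_abs]
    nlinarith [hδ.1]

/-- The frontier of `M` is the union of the nondegenerate segments `[A i, B i]`, and
no interior point of one of these segments lies on another one. -/
structure HasPolygonalFrontier {ι : Type*} (M : Set Plane) (A B : ι → Plane) : Prop where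
  ne : ∀ i, A i ≠ B i
  notMem : ∀ i j, i ≠ j → ∀ x ∈ openSegment ℝ (A i) (B i), x ∉ segment ℝ (A j) (B j)
  frontier_eq : frontier M = ⋃ i, segment ℝ (A i) (B i)

theorem inner_eq_of_mem_segment {n A B z : Plane} (h : inner ℝ n (B - A) = 0)
    (hz : z ∈ segment ℝ A B) : inner ℝ n z = inner ℝ n A := by
  rw [segment_eq_image'] at hz
  obtain ⟨q, -, rfl⟩ := hz
  rw [inner_add_right, inner_smul_right, h, mul_zero, add_zero]

theorem inner_sub_eq_zero_of_mem_segment {P e n A B : Plane} (hf : IsFrame e n) {t : ℝ}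
    (ht : t ≠ 0) (h : P ∈ segment ℝ A B) (h' : P + t • e ∈ segment ℝ A B) :
    inner ℝ n (B - A) = 0 := by
  rw [segment_eq_image'] at h h'
  obtain ⟨p, -, rfl⟩ := h
  obtain ⟨q, -, hq⟩ := h'
  have h1 : (q - p) • (B - A) = t • e := by
    have : t • e = A + q • (B - A) - (A + p • (B - A)) := by
      simp only at hq
      rw [hq]; abel
    rw [this]; module
  have h2 : (q - p) * inner ℝ n (B - A) = 0 := by
    rw [← inner_smul_right, h1, inner_smul_right, hf.orthogonal', mul_zero]
  refine (mul_eq_zero.1 h2).resolve_left fun hc => ?_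
  rw [hc, zero_smul] at h1
  exact smul_ne_zero ht hf.left_ne_zero h1.symm

theorem left_notMem_openSegment {A B : Plane} (h : A ≠ B) : A ∉ openSegment ℝ A B := by
  rw [left_mem_openSegment_iff]
  exact h

theorem eq_add_smul_of_left_add_smul_mem_segment {e n P Q : Plane} (hf : IsFrame e n) {t : ℝ}
    (ht : 0 < t) (h : P + t • e ∈ segment ℝ P Q) : ∃ l > (0 : ℝ), Q = P + l • e := by
  rw [segment_eq_image'] at h
  obtain ⟨m, hm, h⟩ := h
  have h1 : m • (Q - P) = t • e := by simpa using h
  have hm0 : m ≠ 0 := by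
    rintro rfl
    rw [zero_smul] at h1
    exact smul_ne_zero ht.ne' hf.left_ne_zero h1.symm
  have hm1 : 0 < m := lt_of_le_of_ne hm.1 hm0.symm
  refine ⟨m⁻¹ * t, by positivity, ?_⟩
  rw [mul_smul, ← h1, smul_smul, inv_mul_cancel₀ hm0, one_smul, add_sub_cancel]

namespace HasPolygonalFrontier

variable {ι : Type*} {M : Set Plane} {A B : ι → Plane} {P Q e n : Plane}

theorem left_notMem (h : HasPolygonalFrontier M A B) (i j : ι) :
    A i ∉ openSegment ℝ (A j) (B j) := by
  intro hc
  by_cases hij : j = i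
  · subst hij
    exact left_notMem_openSegment (h.ne j) hc
  · exact h.notMem j i hij _ hc (left_mem_segment ℝ _ _)

theorem right_notMem (h : HasPolygonalFrontier M A B) (i j : ι) :
    B i ∉ openSegment ℝ (A j) (B j) := by
  intro hc
  by_cases hij : j = i
  · subst hij
    rw [openSegment_symm] at hc
    exact left_notMem_openSegment (h.ne j).symm hc
  · exact h.notMem j i hij _ hc (right_mem_segment ℝ _ _)

/-- The points `P` and `Q` are the ends of an edge, and `Q` comes after `P` in the direction
of `e`. -/
def IsEdge (A B : ι → Plane) (e P Q : Plane) : Prop :=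
  ∃ i, ∃ l > (0 : ℝ), Q = P + l • e ∧ (A i = P ∧ B i = Q ∨ A i = Q ∧ B i = P)

theorem IsEdge.neg (h : IsEdge A B e P Q) : IsEdge A B (-e) Q P := by
  obtain ⟨i, l, hl, hQ, hi⟩ := h
  exact ⟨i, l, hl, by rw [hQ]; simp, hi.symm⟩

/-- At most one edge leaves `P` in the direction of `e`, since no endpoint is inside an edge. -/
theorem isEdge_unique (h : HasPolygonalFrontier M A B) {Q' : Plane}
    (h1 : IsEdge A B e P Q) (h2 : IsEdge A B e P Q') : Q = Q' := by
  obtain ⟨i, l, hl, hQ, hi⟩ := h1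
  obtain ⟨j, l', hl', hQ', hj⟩ := h2
  have key : ∀ {l l' : ℝ}, 0 < l → l < l' → P + l • e ∈ openSegment ℝ P (P + l' • e) := by
    intro l l' hl hll'
    have hl' := hl.trans hll'
    rw [openSegment_eq_image']
    refine ⟨l / l', ⟨by positivity, (div_lt_one hl').2 hll'⟩, ?_⟩
    simp only [add_sub_cancel_left, smul_smul, div_mul_cancel₀ l hl'.ne']
  have hopen : ∀ {i : ι} {Q : Plane}, (A i = P ∧ B i = Q ∨ A i = Q ∧ B i = P) →
      openSegment ℝ P Q = openSegment ℝ (A i) (B i) ∧ (Q = A i ∨ Q = B i) := by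
    rintro i Q (⟨rfl, rfl⟩ | ⟨rfl, rfl⟩)
    · exact ⟨rfl, Or.inr rfl⟩
    · exact ⟨openSegment_symm _ _ _, Or.inl rfl⟩
  have hend : ∀ {i j : ι} {Q : Plane}, (Q = A i ∨ Q = B i) →
      Q ∉ openSegment ℝ (A j) (B j) := by
    rintro i j Q (rfl | rfl)
    · exact h.left_notMem i j
    · exact h.right_notMem i j
  rcases lt_trichotomy l l' with hll | hll | hll
  · have h3 := key (l' := l') hl hll
    rw [← hQ, ← hQ', (hopen hj).1] at h3
    exact absurd h3 (hend (hopen hi).2)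
  · rw [hQ, hQ', hll]
  · have h3 := key (l' := l) hl' hll
    rw [← hQ, ← hQ', (hopen hi).1] at h3
    exact absurd h3 (hend (hopen hj).2)

variable [Finite ι]

theorem exists_segment_of_jump_ne_zero (h : HasPolygonalFrontier M A B) (hf : IsFrame e n)
    (hj : jump e n M P ≠ 0) :
    ∃ i, ∃ t > (0 : ℝ), P ∈ segment ℝ (A i) (B i) ∧ P + t • e ∈ segment ℝ (A i) (B i) := by
  by_contra! hc
  have h1 : ∀ᶠ δ in 𝓝[>] (0 : ℝ), ∀ i, Disjoint (cone P e n δ) (segment ℝ (A i) (B i)) :=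
    eventually_all.2 fun i => eventually_disjoint_cone_segment hf (hc i)
  obtain ⟨δ, hδ, hδ0⟩ := (h1.and self_mem_nhdsWithin).exists
  refine hj (jump_eq_zero_of_disjoint_cone hf hδ0 ?_)
  rw [h.frontier_eq, Set.disjoint_iUnion_right]
  exact hδ

/-- Along the interior of an edge in the direction of `e`, the set `M` looks the same on the side
of `n`. -/
theorem eventually_mem_arcGerm_iff (h : HasPolygonalFrontier M A B) (hf : IsFrame e n) {i : ι}
    (hP : P ∈ openSegment ℝ (A i) (B i)) (hn : inner ℝ n (B i - A i) = 0) :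
    ∀ᶠ x in 𝓝 (0 : ℝ), (M ∈ arcGerm (P + x • e) e n ↔ M ∈ arcGerm P e n) ∧
      (M ∈ arcGerm (P + x • e) (-e) n ↔ M ∈ arcGerm P e n) := by
  have hclosed : IsClosed (⋃ j ∈ {j | j ≠ i}, segment ℝ (A j) (B j)) :=
    (Set.toFinite _).isClosed_biUnion fun j _ => isClosed_segment _ _
  obtain ⟨r, hr, hball⟩ := Metric.isOpen_iff.1 hclosed.isOpen_compl P (by
    simp only [Set.mem_compl_iff, Set.mem_iUnion, not_exists]
    exact fun j hj => h.notMem i j (Ne.symm hj) P hP)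
  have hi : ∀ z ∈ segment ℝ (A i) (B i), inner ℝ n z = inner ℝ n P := fun z hz => by
    rw [inner_eq_of_mem_segment hn hz,
      inner_eq_of_mem_segment hn (openSegment_subset_segment _ _ _ hP)]
  -- The upper half of a small disc about `P` does not meet the frontier.
  let U : Set Plane := Metric.ball P r ∩ {z | inner ℝ n P < inner ℝ n z}
  have hU : IsPreconnected U := ((convex_ball P r).inter
    (convex_halfSpace_gt (isLinearMap_inner n) _)).isPreconnected
  have hUd : Disjoint U (frontier M) := by
    rw [h.frontier_eq, Set.disjoint_iUnion_right]
    intro j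
    refine Set.disjoint_left.2 fun z hz hzj => ?_
    by_cases hj : j = i
    · subst hj
      exact hz.2.ne' (hi z hzj)
    · exact hball hz.1 (Set.mem_biUnion hj hzj)
  have hmem : ∀ x : ℝ, P + x • e ∈ Metric.ball P r → ∀ e' : Plane, IsFrame e' n →
      inner ℝ n e' = 0 → U ∈ arcGerm (P + x • e) e' n := by
    intro x hx e' hf' hn'
    apply mem_arcGerm_of_eventually
    have hcont : Tendsto (fun t : ℝ => P + x • e + t • e' + t ^ 2 • n) (𝓝[>] 0)
        (𝓝 (P + x • e)) := by
      have : Continuous fun t : ℝ => P + x • e + t • e' + t ^ 2 • n := by fun_prop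
      simpa using (this.tendsto 0).mono_left nhdsWithin_le_nhds
    filter_upwards [hcont.eventually (Metric.isOpen_ball.mem_nhds hx), self_mem_nhdsWithin]
      with t ht ht0
    refine ⟨ht, ?_⟩
    have ht0 : 0 < t := ht0
    rw [Set.mem_ofPred_eq, inner_arc, inner_add_right, inner_smul_right, hf.orthogonal', hn',
      hf.inner_right]
    nlinarith
  have hx : ∀ᶠ x in 𝓝 (0 : ℝ), P + x • e ∈ Metric.ball P r := by
    have : Continuous fun x : ℝ => P + x • e := by fun_prop
    have h1 : Tendsto (fun x : ℝ => P + x • e) (𝓝 0) (𝓝 P) := by simpa using this.tendsto 0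
    exact h1.eventually (Metric.ball_mem_nhds P hr)
  have h0 : U ∈ arcGerm P e n := by
    simpa using hmem 0 (by simpa using hr) e hf hf.orthogonal'
  filter_upwards [hx] with x hx
  exact ⟨mem_iff_mem_of_isPreconnected hU hUd (hmem x hx e hf hf.orthogonal') h0,
    mem_iff_mem_of_isPreconnected hU hUd
      (hmem x hx (-e) hf.neg_left (by simp [hf.orthogonal'])) h0⟩

theorem arcIndicator_neg_eq (h : HasPolygonalFrontier M A B) (hf : IsFrame e n) {i : ι}
    (hP : P ∈ openSegment ℝ (A i) (B i)) (hn : inner ℝ n (B i - A i) = 0) :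
    arcIndicator (-e) n M P = arcIndicator e n M P :=
  arcIndicator_congr (by
    simpa using (h.eventually_mem_arcGerm_iff hf hP hn).self_of_nhds.2)

/-- Corner signs vanish away from the endpoints of the edges. -/
theorem cornerSign_eq_zero (h : HasPolygonalFrontier M A B) (hf : IsFrame e n)
    (hA : ∀ i, P ≠ A i) (hB : ∀ i, P ≠ B i) : cornerSign e n M P = 0 := by
  by_contra hc
  obtain ⟨i, t, ht, h1, h2⟩ : ∃ i, ∃ t : ℝ, t ≠ 0 ∧ P ∈ segment ℝ (A i) (B i) ∧
      P + t • e ∈ segment ℝ (A i) (B i) := by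
    by_cases hj : jump e n M P = 0
    · have hj' : jump (-e) n M P ≠ 0 := by
        intro hj'
        rw [cornerSign, hj, hj', sub_zero] at hc
        exact hc rfl
      obtain ⟨i, t, ht, h1, h2⟩ := h.exists_segment_of_jump_ne_zero hf.neg_left hj'
      exact ⟨i, -t, by linarith, h1, by simpa using h2⟩
    · obtain ⟨i, t, ht, h1, h2⟩ := h.exists_segment_of_jump_ne_zero hf hj
      exact ⟨i, t, ht.ne', h1, h2⟩
  have hn := inner_sub_eq_zero_of_mem_segment hf ht h1 h2
  have hP := mem_openSegment_of_ne_left_right (hA i).symm (hB i).symm h1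
  refine hc ?_
  rw [cornerSign, jump, jump, h.arcIndicator_neg_eq hf hP hn,
    h.arcIndicator_neg_eq hf.neg_right hP (by simp [hn]), sub_self]

theorem exists_isEdge_of_jump_ne_zero (h : HasPolygonalFrontier M A B) (hf : IsFrame e n)
    (hP : P ∈ Set.range A ∪ Set.range B) (hj : jump e n M P ≠ 0) : ∃ Q, IsEdge A B e P Q := by
  obtain ⟨i, t, ht, h1, h2⟩ := h.exists_segment_of_jump_ne_zero hf hj
  have hPi : P = A i ∨ P = B i := by
    by_contra! hc
    have h3 := mem_openSegment_of_ne_left_right hc.1.symm hc.2.symm h1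
    rcases hP with ⟨k, rfl⟩ | ⟨k, rfl⟩
    · exact h.left_notMem k i h3
    · exact h.right_notMem k i h3
  rcases hPi with rfl | rfl
  · obtain ⟨l, hl, hQ⟩ := eq_add_smul_of_left_add_smul_mem_segment hf ht h2
    exact ⟨B i, i, l, hl, hQ, Or.inl ⟨rfl, rfl⟩⟩
  · rw [segment_symm] at h2
    obtain ⟨l, hl, hQ⟩ := eq_add_smul_of_left_add_smul_mem_segment hf ht h2
    exact ⟨A i, i, l, hl, hQ, Or.inr ⟨rfl, rfl⟩⟩

end HasPolygonalFrontier

theorem IsDissection.eventually_mem_arcGerm_add_smul_iff {M : Set Plane} {k : ℕ}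
    {T : Fin k → PlaneRectangle} (hT : IsDissection M T) {P e n : Plane} (hf : IsFrame e n) :
    ∀ᶠ x in 𝓝[>] (0 : ℝ), (M ∈ arcGerm (P + x • e) e n ↔ M ∈ arcGerm P e n) := by
  have : ∀ᶠ x in 𝓝[>] (0 : ℝ), ∀ i, ((T i).carrier ∈ arcGerm (P + x • e) e n ↔
      (T i).carrier ∈ arcGerm P e n) :=
    eventually_all.2 fun i => (T i).eventually_mem_arcGerm_add_smul_iff hf
  filter_upwards [this] with x hx
  rw [hT.mem_arcGerm_iff, hT.mem_arcGerm_iff]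
  exact exists_congr hx

namespace HasPolygonalFrontier

variable {ι : Type*} [Finite ι] {M : Set Plane} {A B : ι → Plane} {P Q e n : Plane}

/-- On the side of `n`, the set `M` looks the same near both ends of an edge. -/
theorem mem_arcGerm_iff_of_isEdge (h : HasPolygonalFrontier M A B) {k : ℕ}
    {T : Fin k → PlaneRectangle} (hT : IsDissection M T) (hf : IsFrame e n)
    (hPQ : IsEdge A B e P Q) : M ∈ arcGerm P e n ↔ M ∈ arcGerm Q (-e) n := by
  obtain ⟨i, l, hl, hQ, hi⟩ := hPQ
  have hseg : segment ℝ P Q = segment ℝ (A i) (B i) ∧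
      openSegment ℝ P Q = openSegment ℝ (A i) (B i) := by
    rcases hi with ⟨rfl, rfl⟩ | ⟨rfl, rfl⟩
    · exact ⟨rfl, rfl⟩
    · exact ⟨segment_symm _ _ _, openSegment_symm _ _ _⟩
  have hn : inner ℝ n (B i - A i) = 0 := by
    refine inner_sub_eq_zero_of_mem_segment hf hl.ne' (P := P) ?_ ?_
    · rw [← hseg.1]; exact left_mem_segment ℝ _ _
    · rw [← hseg.1, ← hQ]; exact right_mem_segment ℝ _ _
  have hopen : ∀ x ∈ Set.Ioo 0 l, P + x • e ∈ openSegment ℝ (A i) (B i) := by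
    intro x hx
    rw [← hseg.2, hQ, openSegment_eq_image']
    refine ⟨x / l, ⟨div_pos hx.1 hl, (div_lt_one hl).2 hx.2⟩, ?_⟩
    simp only [add_sub_cancel_left, smul_smul, div_mul_cancel₀ x hl.ne']
  have hconst : ∀ {x y : ℝ}, x ∈ Set.Ioo 0 l → y ∈ Set.Ioo 0 l →
      (M ∈ arcGerm (P + x • e) e n ↔ M ∈ arcGerm (P + y • e) e n) := by
    intro x y hx hy
    refine isPreconnected_Ioo.induction₂
      (fun x y => M ∈ arcGerm (P + x • e) e n ↔ M ∈ arcGerm (P + y • e) e n)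
      (fun x hx => ?_) (fun _ _ _ _ _ _ h1 h2 => h1.trans h2) (fun _ _ _ _ h => h.symm) hx hy
    have h1 : Tendsto (fun y : ℝ => y - x) (𝓝 x) (𝓝 0) := by
      have : Continuous fun y : ℝ => y - x := by fun_prop
      simpa using this.tendsto x
    refine ((h1.eventually (h.eventually_mem_arcGerm_iff hf (hopen x hx) hn)).mono
      fun y hy => ?_).filter_mono nhdsWithin_le_nhds
    have h2 : P + x • e + (y - x) • e = P + y • e := by module
    rw [h2] at hy
    exact hy.1.symm
  obtain ⟨x, hx, hxI⟩ := ((hT.eventually_mem_arcGerm_add_smul_iff hf (P := P)).and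
    (Ioo_mem_nhdsGT hl)).exists
  obtain ⟨y, hy, hyI⟩ := ((hT.eventually_mem_arcGerm_add_smul_iff hf.neg_left (P := Q)).and
    (Ioo_mem_nhdsGT hl)).exists
  have hyI' : l - y ∈ Set.Ioo 0 l := ⟨by linarith [hyI.2], by linarith [hyI.1]⟩
  have hQy : Q + y • -e = P + (l - y) • e := by rw [hQ]; module
  rw [← hx, ← hy, hQy, hconst hxI hyI']
  simpa using (h.eventually_mem_arcGerm_iff hf (hopen _ hyI') hn).self_of_nhds.2.symm

theorem jump_eq_of_isEdge (h : HasPolygonalFrontier M A B) {k : ℕ}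
    {T : Fin k → PlaneRectangle} (hT : IsDissection M T) (hf : IsFrame e n)
    (hPQ : IsEdge A B e P Q) : jump e n M P = jump (-e) n M Q := by
  rw [jump, jump, arcIndicator_congr (h.mem_arcGerm_iff_of_isEdge hT hf hPQ),
    arcIndicator_congr (h.mem_arcGerm_iff_of_isEdge hT hf.neg_right hPQ)]

/-- If `f` kills the lengths of the edges, then the corner sums vanish: the two ends of an edge in
the direction of `e` contribute opposite terms. -/
theorem cornerSum_eq_zero (h : HasPolygonalFrontier M A B) {k : ℕ}
    {T : Fin k → PlaneRectangle} (hT : IsDissection M T) (hf : IsFrame e n) (f g : ℝ →+ ℝ)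
    (hfl : ∀ i, f (dist (A i) (B i)) = 0) : cornerSum e n f g M = 0 := by
  classical
  have hfin : (Set.range A ∪ Set.range B).Finite := (Set.finite_range A).union (Set.finite_range B)
  have hedge : ∀ P Q, IsEdge A B e P Q →
      f (inner ℝ e Q) * g (inner ℝ n Q) = f (inner ℝ e P) * g (inner ℝ n P) := by
    rintro P Q ⟨i, l, hl, hQ, hi⟩
    have hd : dist (A i) (B i) = l := by
      have : dist P Q = l := by
        rw [hQ, dist_self_add_right, norm_smul, hf.norm_left, mul_one, Real.norm_of_nonneg hl.le]
      rcases hi with ⟨rfl, rfl⟩ | ⟨rfl, rfl⟩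
      · exact this
      · rwa [dist_comm]
    rw [hQ, inner_add_right, inner_add_right, inner_smul_right, inner_smul_right, hf.inner_left,
      hf.orthogonal', mul_one, mul_zero, add_zero, map_add, ← hd, hfl i, add_zero]
  have hrange : ∀ {P Q}, IsEdge A B e P Q → P ∈ hfin.toFinset ∧ Q ∈ hfin.toFinset := by
    rintro P Q ⟨i, l, hl, hQ, ⟨rfl, rfl⟩ | ⟨rfl, rfl⟩⟩ <;> simp
  rw [cornerSum, finsum_eq_sum_of_support_subset (s := hfin.toFinset)]
  · simp only [cornerSign, sub_mul, Finset.sum_sub_distrib]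
    rw [sub_eq_zero]
    have hex : ∀ P ∈ hfin.toFinset,
        jump e n M P * (f (inner ℝ e P) * g (inner ℝ n P)) ≠ 0 → ∃ Q, IsEdge A B e P Q :=
      fun P hP hne => h.exists_isEdge_of_jump_ne_zero hf (hfin.mem_toFinset.1 hP)
        (left_ne_zero_of_mul hne)
    refine Finset.sum_bij_ne_zero (fun P hP hne => (hex P hP hne).choose) ?_ ?_ ?_ ?_
    · intro P hP hne
      exact (hrange (hex P hP hne).choose_spec).2
    · intro P hP hne P' hP' hne' heq
      have h1 := (hex P hP hne).choose_spec
      have h2 := (hex P' hP' hne').choose_spec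
      rw [← heq] at h2
      exact h.isEdge_unique h1.neg h2.neg
    · intro Q hQ hne
      obtain ⟨P, hP⟩ := h.exists_isEdge_of_jump_ne_zero hf.neg_left (hfin.mem_toFinset.1 hQ)
        (left_ne_zero_of_mul hne)
      have hPQ : IsEdge A B e P Q := by simpa using hP.neg
      have hne' : jump e n M P * (f (inner ℝ e P) * g (inner ℝ n P)) ≠ 0 := by
        rwa [h.jump_eq_of_isEdge hT hf hPQ, ← hedge P Q hPQ]
      refine ⟨P, (hrange hPQ).1, hne', ?_⟩
      exact h.isEdge_unique (hex P (hrange hPQ).1 hne').choose_spec hPQ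
    · intro P hP hne
      have h1 := (hex P hP hne).choose_spec
      rw [h.jump_eq_of_isEdge hT hf h1, hedge _ _ h1]
  · intro P hP
    rw [hfin.coe_toFinset]
    by_contra hc
    simp only [Set.mem_union, Set.mem_range, not_or, not_exists] at hc
    exact left_ne_zero_of_mul hP
      (h.cornerSign_eq_zero hf (fun i hi => hc.1 i hi.symm) (fun i hi => hc.2 i hi.symm))

end HasPolygonalFrontier

theorem PolygonalRegion.hasPolygonalFrontier (M : PolygonalRegion) :
    HasPolygonalFrontier M.carrier
      (fun q : Σ i, Fin (M.numEdges i) => M.curve q.1 q.2)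
      (fun q => M.curve q.1 (finRotate _ q.2)) := by
  have hseg : ∀ i j, (M.curve i).edgeSet ℝ j =
      segment ℝ (M.curve i j) (M.curve i (finRotate _ j)) := fun i j =>
    affineSegment_eq_segment _ _ _
  refine ⟨fun q => (M.isSimple q.1).nondegenerate q.2, ?_, ?_⟩
  · rintro ⟨i, j⟩ ⟨i', j'⟩ hne x hx hx'
    simp only at hx hx'
    have hxs := openSegment_subset_segment _ _ _ hx
    by_cases hi : i = i'
    · subst hi
      have hj : j ≠ j' := fun hj => hne (by rw [hj])
      have hnd := (M.isSimple i).nondegenerate j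
      rw [← hseg] at hxs hx'
      rcases (M.isSimple i).inter j j' hj x ⟨hxs, hx'⟩ with ⟨h1, h2⟩ | ⟨h1, h2⟩
      · rw [h2, h1, openSegment_symm] at hx
        exact left_notMem_openSegment hnd.symm hx
      · rw [h2] at hx
        exact left_notMem_openSegment hnd hx
    · exact Set.disjoint_left.1 (M.disjoint i i' hi) (Set.mem_iUnion.2 ⟨j, by rwa [hseg]⟩)
        (Set.mem_iUnion.2 ⟨j', by rwa [hseg]⟩)
  · rw [M.frontier_eq, Set.iUnion_sigma]
    exact Set.iUnion_congr fun i => Set.iUnion_congr fun j => hseg i j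

theorem PolygonalRegion.cornerSum_eq_zero (M : PolygonalRegion) {k : ℕ}
    {T : Fin k → PlaneRectangle} (hT : IsDissection M.carrier T) {e n : Plane} (hf : IsFrame e n)
    (f g : ℝ →+ ℝ) (hfl : ∀ i j, f (M.sideLength i j) = 0) :
    cornerSum e n f g M.carrier = 0 :=
  M.hasPolygonalFrontier.cornerSum_eq_zero hT hf f g fun q => hfl q.1 q.2

end Germs

/-! ### Quadratic numbers -/

/-- For every `α ≠ 0` there is an additive function on `ℝ` that is semilinear for the conjugation
of `ℚ[√p]` and takes the value `1` at `α`. -/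
theorem exists_conj_semilinear {p : ℚ} (hp : 0 < p) (hirr : Irrational √(p : ℝ)) {α : ℝ}
    (hα : α ≠ 0) : ∃ G : ℝ →+ ℝ, G α = 1 ∧ ∀ (c d : ℚ) (s : ℝ),
      G (((c : ℝ) + d * √(p : ℝ)) * s) = ((c : ℝ) - d * √(p : ℝ)) * G s := by
  have hp' : (0 : ℝ) < p := by exact_mod_cast hp
  have hr : √(p : ℝ) * √(p : ℝ) = p := Real.mul_self_sqrt hp'.le
  have hr0 : √(p : ℝ) ≠ 0 := (Real.sqrt_pos.2 hp').ne'
  generalize √(p : ℝ) = r at *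
  have hmem : α ∉ Submodule.span ℚ {r * α} := by
    intro h
    obtain ⟨q, hq⟩ := Submodule.mem_span_singleton.1 h
    rw [Rat.smul_def] at hq
    have h1 : (q : ℝ) * r = 1 := by
      apply mul_right_cancel₀ hα
      rw [mul_assoc, hq, one_mul]
    have hq0 : (q : ℝ) ≠ 0 := left_ne_zero_of_mul (h1 ▸ one_ne_zero)
    exact hirr ⟨q⁻¹, by
      rw [Rat.cast_inv, ← mul_left_cancel₀ hq0 (h1.trans (mul_inv_cancel₀ hq0).symm)]⟩
  obtain ⟨ψ, hψ0, hψ1⟩ := LinearMap.exists_extend_of_notMem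
    (0 : Submodule.span ℚ {r * α} →ₗ[ℚ] ℚ) hmem 1
  have hψ2 : ψ (r * α) = 0 := by
    have := congrArg (fun φ => φ ⟨r * α, Submodule.mem_span_singleton_self _⟩) hψ0
    simpa using this
  have hψq : ∀ (q : ℚ) (s : ℝ), ψ ((q : ℝ) * s) = q * ψ s := by
    intro q s
    rw [← Rat.smul_def, map_smul, smul_eq_mul]
  -- The `ℚ[√p]`-linear extension of `ψ` is `ψ s + ψ (√p s) / √p`; `G` is its conjugate.
  refine ⟨AddMonoidHom.mk' (fun s => (ψ s : ℝ) - ψ (r * s) / r) ?_, ?_, ?_⟩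
  · intro s t
    rw [mul_add, map_add, map_add]
    push_cast
    ring
  · simp [hψ1, hψ2]
  · intro c d s
    have h1 : ((c : ℝ) + d * r) * s = c * s + d * (r * s) := by ring
    have h2 : r * (((c : ℝ) + d * r) * s) = c * (r * s) + (d * p : ℚ) * s := by
      push_cast
      rw [← hr]; ring
    simp only [AddMonoidHom.mk'_apply]
    rw [h2, h1, map_add, map_add, hψq, hψq, hψq, hψq]
    push_cast
    rw [← hr]
    field_simp
    ring

/-- The arithmetic of the necessary condition: `A`, `D`, `E` are the squared norms and the inner
product of two vectors, and `x`, `y` are multiplied by `A`, their conjugates by `D`, and their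
traces by `E`. -/
theorem isConicCombination_of_forms {a b c d p : ℚ} (hp : 0 < p) (hirr : Irrational √(p : ℝ))
    {A D E : ℝ} (hx : 0 < (a : ℝ) + b * √(p : ℝ)) (hy : 0 < (c : ℝ) + d * √(p : ℝ)) (hD : 0 ≤ D)
    (hE : E ^ 2 ≤ A * D) (h1 : (c : ℝ) + d * √(p : ℝ) = (a + b * √(p : ℝ)) * A)
    (h2 : (c : ℝ) - d * √(p : ℝ) = (a - b * √(p : ℝ)) * D) (h3 : (c : ℝ) = a * E) :
    IsConicCombination ((a : ℝ) + b * √(p : ℝ)) ((c : ℝ) + d * √(p : ℝ)) := by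
  have hp' : (0 : ℝ) < p := by exact_mod_cast hp
  have hr : √(p : ℝ) * √(p : ℝ) = p := Real.mul_self_sqrt hp'.le
  have hr0 : 0 < √(p : ℝ) := Real.sqrt_pos.2 hp'
  generalize √(p : ℝ) = r at *
  by_cases ha : a = 0
  · subst ha
    simp only [Rat.cast_zero, zero_add, zero_mul] at *
    rw [h3, zero_add] at hy ⊢
    have hb : (0 : ℝ) < b := pos_of_mul_pos_left hx hr0.le
    have hd : (0 : ℝ) < d := pos_of_mul_pos_left hy hr0.le
    refine ⟨d / b, 0, ?_, le_rfl, ?_⟩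
    · have hb : 0 < b := by exact_mod_cast hb
      have hd : 0 < d := by exact_mod_cast hd
      positivity
    · push_cast
      field_simp
      ring
  have ha' : (a : ℝ) ≠ 0 := by exact_mod_cast ha
  have hEe : E = (c / a : ℚ) := by
    push_cast
    rw [h3]; field_simp
  have hnorm : (c : ℝ) ^ 2 - p * d ^ 2 = (a ^ 2 - p * b ^ 2) * (A * D) := by
    have : ((c : ℝ) + d * r) * (c - d * r) = (a + b * r) * A * ((a - b * r) * D) := by
      rw [h1, h2]
    rw [← hr]
    linear_combination this
  by_cases hb : b = 0
  · subst hb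
    simp only [Rat.cast_zero, zero_mul, add_zero] at *
    have hd : (p : ℝ) * d ^ 2 ≤ 0 := by
      have h4 : (c : ℝ) ^ 2 = a ^ 2 * E ^ 2 := by rw [h3]; ring
      have h5 : (a : ℝ) ^ 2 * E ^ 2 ≤ a ^ 2 * (A * D) := by gcongr
      linarith
    have hd0 : (d : ℝ) = 0 := by
      have := nonpos_of_mul_nonpos_right hd hp'
      exact pow_eq_zero_iff two_ne_zero |>.1 (le_antisymm this (sq_nonneg _))
    rw [hd0, zero_mul, add_zero] at hy ⊢
    refine ⟨c / a, 0, ?_, le_rfl, ?_⟩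
    · have hc : 0 < c := by exact_mod_cast hy
      have ha : 0 < a := by exact_mod_cast hx
      positivity
    · push_cast
      field_simp
      ring
  have hb' : (b : ℝ) ≠ 0 := by exact_mod_cast hb
  have hx' : (a : ℝ) - b * r ≠ 0 := by
    intro h
    refine hirr ⟨a / b, ?_⟩
    push_cast
    rw [div_eq_iff hb']
    linarith
  have hN : ((a : ℝ) + b * r) * (a - b * r) = a ^ 2 - p * b ^ 2 := by
    rw [← hr]; ring
  have hEb : (c : ℝ) ^ 2 - p * b ^ 2 * E ^ 2 = (a ^ 2 - p * b ^ 2) * E ^ 2 := by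
    rw [h3]; ring
  have hdb : ((d : ℝ) / b) ^ 2 * b ^ 2 = d ^ 2 := by
    rw [← mul_pow, div_mul_cancel₀ _ hb']
  have hpb : 0 < (p : ℝ) * b ^ 2 := by positivity
  -- With `E = c / a`, the coefficients of `x` and of its conjugate in `y` are `(E ± d / b) / 2`.
  suffices h : 0 ≤ E + d / b ∧ 0 ≤ (E - d / b) * (a ^ 2 - p * b ^ 2) by
    rw [hEe] at h
    refine ⟨(c / a + d / b) / 2, (c / a - d / b) / 2 * (a ^ 2 - p * b ^ 2), ?_, ?_, ?_⟩
    · have : 0 ≤ c / a + d / b := by exact_mod_cast h.1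
      positivity
    · have : 0 ≤ (c / a - d / b) * (a ^ 2 - p * b ^ 2) := by exact_mod_cast h.2
      linarith
    · have hx0 := hx.ne'
      push_cast
      rw [← hN, mul_assoc, mul_comm (_ * _) (_ : ℝ)⁻¹, inv_mul_cancel_left₀ hx0]
      field_simp
      ring
  rcases lt_or_gt_of_ne hx' with hneg | hpos
  · have hb0 : (0 : ℝ) < b := by
      by_contra! hc
      nlinarith
    have hN0 : (a : ℝ) ^ 2 - p * b ^ 2 < 0 := by
      rw [← hN]; exact mul_neg_of_pos_of_neg hx hneg
    have hd0 : (0 : ℝ) < d := by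
      by_contra! hc
      nlinarith
    have h5 : (a ^ 2 - p * b ^ 2) * (A * D) ≤ (a ^ 2 - p * b ^ 2) * E ^ 2 :=
      mul_le_mul_of_nonpos_left hE hN0.le
    have h6 : E ^ 2 ≤ ((d : ℝ) / b) ^ 2 := by
      have : (p : ℝ) * b ^ 2 * E ^ 2 ≤ p * b ^ 2 * ((d : ℝ) / b) ^ 2 := by
        rw [mul_assoc (p : ℝ) _ (((d : ℝ) / b) ^ 2), mul_comm _ (((d : ℝ) / b) ^ 2), hdb]
        linarith
      exact le_of_mul_le_mul_left this hpb
    have h7 := abs_le_of_sq_le_sq' h6 (by positivity)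
    exact ⟨by linarith, mul_nonneg_of_nonpos_of_nonpos (by linarith) hN0.le⟩
  · have hN0 : 0 < (a : ℝ) ^ 2 - p * b ^ 2 := by
      rw [← hN]; exact mul_pos hx hpos
    have hE0 : 0 ≤ E := by
      have ha0 : (0 : ℝ) < a := by linarith
      have hc0 : (0 : ℝ) < c := by
        have := mul_nonneg hpos.le hD
        linarith
      by_contra! hc
      nlinarith
    have h5 : (a ^ 2 - p * b ^ 2) * E ^ 2 ≤ (a ^ 2 - p * b ^ 2) * (A * D) :=
      mul_le_mul_of_nonneg_left hE hN0.le
    have h6 : ((d : ℝ) / b) ^ 2 ≤ E ^ 2 := by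
      have : (p : ℝ) * b ^ 2 * ((d : ℝ) / b) ^ 2 ≤ p * b ^ 2 * E ^ 2 := by
        rw [mul_assoc (p : ℝ) _ (((d : ℝ) / b) ^ 2), mul_comm _ (((d : ℝ) / b) ^ 2), hdb]
        linarith
      exact le_of_mul_le_mul_left this hpb
    have h7 := abs_le_of_sq_le_sq' h6 hE0
    exact ⟨by linarith, mul_nonneg (by linarith) hN0.le⟩

theorem div_mem_quadraticNumbers {p : ℚ} (hp : 0 < p) (hirr : Irrational √(p : ℝ)) {s t : ℝ}
    (hs : s ∈ quadraticNumbers p) (ht : t ∈ quadraticNumbers p) : t / s ∈ quadraticNumbers p := by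
  obtain ⟨c, d, rfl⟩ := hs
  obtain ⟨c', d', rfl⟩ := ht
  have hp' : (0 : ℝ) < p := by exact_mod_cast hp
  have hr : √(p : ℝ) * √(p : ℝ) = p := Real.mul_self_sqrt hp'.le
  unfold quadraticNumbers
  rw [Set.mem_ofPred_eq]
  generalize √(p : ℝ) = r at *
  by_cases h0 : (c : ℝ) + d * r = 0
  · exact ⟨0, 0, by simp [h0]⟩
  have h1 : (c : ℝ) - d * r ≠ 0 := by
    intro h
    by_cases hd : (d : ℝ) = 0
    · rw [hd] at h h0
      simp at h h0
      exact h0 h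
    · refine hirr ⟨c / d, ?_⟩
      push_cast
      rw [div_eq_iff hd]
      linarith
  have h2 : (c : ℝ) ^ 2 - p * d ^ 2 ≠ 0 := by
    have : (c : ℝ) ^ 2 - p * d ^ 2 = (c + d * r) * (c - d * r) := by rw [← hr]; ring
    rw [this]
    exact mul_ne_zero h0 h1
  refine ⟨(c' * c - p * d' * d) / (c ^ 2 - p * d ^ 2), (d' * c - c' * d) / (c ^ 2 - p * d ^ 2), ?_⟩
  push_cast
  rw [div_eq_iff h0]
  field_simp
  linear_combination ((c' : ℝ) * d ^ 2 - d' * c * d) * hr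

/-! ### Side ratios of tiles -/

namespace PlaneRectangle

theorem HasRatio.exists_sideForm_eq {R : PlaneRectangle} {r : ℝ} (h : R.HasRatio r) :
    ∃ s : ℝ, 0 < s ∧ ∀ f g : ℝ →+ ℝ, R.sideForm f g = f s * g (r * s) + f (r * s) * g s := by
  rcases h with h | h
  · exact ⟨‖R.v‖, R.norm_v_pos, fun f g => by rw [sideForm, h]; ring⟩
  · exact ⟨‖R.u‖, R.norm_u_pos, fun f g => by rw [sideForm, h]⟩

theorem sideForm_eq_of_sides_eq {R R' : PlaneRectangle} (h : R.sides = R'.sides) (f g : ℝ →+ ℝ) :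
    R.sideForm f g = R'.sideForm f g := by
  rw [sides, sides, Sym2.eq_iff] at h
  rcases h with ⟨h1, h2⟩ | ⟨h1, h2⟩
  · rw [sideForm, sideForm, h1, h2]
  · rw [sideForm, sideForm, h1, h2]; ring

end PlaneRectangle

theorem exists_sum_sideForm_eq {k : ℕ} {T : Fin k → PlaneRectangle} (i₀ : Fin k) {y : ℝ}
    (heq : ∀ i j, (T i).sides = (T j).sides) (hy : (T i₀).HasRatio y) :
    ∃ α : ℝ, 0 < α ∧ ∀ f g : ℝ →+ ℝ,
      ∑ i, (T i).sideForm f g = k * (f α * g (y * α) + f (y * α) * g α) := by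
  obtain ⟨α, hα, h⟩ := hy.exists_sideForm_eq
  refine ⟨α, hα, fun f g => ?_⟩
  rw [← h, Finset.sum_congr rfl fun i _ => PlaneRectangle.sideForm_eq_of_sides_eq (heq i i₀) f g]
  simp

/-- If a set can be cut into equal rectangles with side ratio `y` and into similar rectangles with
side ratio `x`, where `x` and `y` are in `ℚ[√p]`, then `y` is a conic combination of `x` and
`1 / x`. -/
theorem isConicCombination_of_isDissection {a b p : ℚ} (hp : 0 < p) (hirr : Irrational √(p : ℝ))
    {M : Set Plane} {y : ℝ} (hy : y ∈ quadraticNumbers p) {k : ℕ} {T : Fin k → PlaneRectangle}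
    (hT : IsDissection M T) (i₀ : Fin k) (heq : ∀ i j, (T i).sides = (T j).sides)
    (hTy : (T i₀).HasRatio y) {m : ℕ} {S : Fin m → PlaneRectangle} (hS : IsDissection M S)
    (hSx : ∀ i, (S i).HasRatio ((a : ℝ) + b * √(p : ℝ)))
    (hx : 0 < (a : ℝ) + b * √(p : ℝ)) :
    IsConicCombination ((a : ℝ) + b * √(p : ℝ)) y := by
  obtain ⟨α, hα, hTsum⟩ := exists_sum_sideForm_eq i₀ heq hTy
  choose s _ hs using fun i => (hSx i).exists_sideForm_eq
  have hy0 := hTy.pos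
  have hk : (0 : ℝ) < k := by exact_mod_cast i₀.pos
  have hsum : ∀ f g : ℝ →+ ℝ, k * (f α * g (y * α) + f (y * α) * g α) =
      ∑ i, (f (s i) * g (((a : ℝ) + b * √(p : ℝ)) * s i) +
        f (((a : ℝ) + b * √(p : ℝ)) * s i) * g (s i)) := by
    intro f g
    rw [← hTsum, hT.sum_sideForm_congr hS f g fun _ _ _ => rfl]
    exact Finset.sum_congr rfl fun i _ => hs i f g
  obtain ⟨c, d, rfl⟩ := hy
  obtain ⟨G, hG1, hG⟩ := exists_conj_semilinear hp hirr hα.ne'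
  have hF : ∀ t s : ℝ, AddMonoidHom.mulRight α⁻¹ (t * s) = t * AddMonoidHom.mulRight α⁻¹ s :=
    fun t s => mul_assoc _ _ _
  have hF1 : AddMonoidHom.mulRight α⁻¹ α = 1 := mul_inv_cancel₀ hα.ne'
  generalize AddMonoidHom.mulRight α⁻¹ = F at hF hF1
  have hFF := hsum F F
  have hGG := hsum G G
  have hFG := hsum F G
  simp only [hF, hF1, hG, hG1] at hFF hGG hFG
  set x : ℝ := (a : ℝ) + b * √(p : ℝ) with hxdef
  have e1 : ∑ i, (F (s i) * (x * F (s i)) + x * F (s i) * F (s i)) =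
      2 * x * ∑ i, F (s i) ^ 2 := by
    rw [Finset.mul_sum]
    exact Finset.sum_congr rfl fun i _ => by ring
  have e2 : ∑ i, (G (s i) * (((a : ℝ) - b * √(p : ℝ)) * G (s i)) +
      ((a : ℝ) - b * √(p : ℝ)) * G (s i) * G (s i)) =
      2 * ((a : ℝ) - b * √(p : ℝ)) * ∑ i, G (s i) ^ 2 := by
    rw [Finset.mul_sum]
    exact Finset.sum_congr rfl fun i _ => by ring
  have e3 : ∑ i, (F (s i) * (((a : ℝ) - b * √(p : ℝ)) * G (s i)) + x * F (s i) * G (s i)) =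
      2 * a * ∑ i, F (s i) * G (s i) := by
    rw [Finset.mul_sum]
    exact Finset.sum_congr rfl fun i _ => by rw [hxdef]; ring
  rw [e1] at hFF
  rw [e2] at hGG
  rw [e3] at hFG
  have hCS := Finset.sum_mul_sq_le_sq_mul_sq Finset.univ (fun i => F (s i)) (fun i => G (s i))
  have hD : 0 ≤ ∑ i, G (s i) ^ 2 := Finset.sum_nonneg fun i _ => sq_nonneg _
  generalize ∑ i, F (s i) ^ 2 = A at *
  generalize ∑ i, G (s i) ^ 2 = D at *
  generalize ∑ i, F (s i) * G (s i) = E at *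
  refine isConicCombination_of_forms hp hirr (A := A / k) (D := D / k) (E := E / k) hx hy0
    (by positivity) ?_ ?_ ?_ ?_
  · rw [div_pow, div_mul_div_comm, ← sq]
    gcongr
  · field_simp
    linarith
  · field_simp
    linarith
  · field_simp
    linarith

/-- Equal rectangles that tile a polygon with sides in `ℚ[√p]` have their side ratio in
`ℚ[√p]`. -/
theorem PolygonalRegion.ratio_mem_quadraticNumbers {p : ℚ} (hp : 0 < p)
    (hirr : Irrational √(p : ℝ)) (M : PolygonalRegion)
    (hM : ∀ i j, M.sideLength i j ∈ quadraticNumbers p) {y : ℝ} {k : ℕ}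
    {T : Fin k → PlaneRectangle} (hT : IsDissection M.carrier T) (i₀ : Fin k)
    (heq : ∀ i j, (T i).sides = (T j).sides) (hTy : (T i₀).HasRatio y) :
    y ∈ quadraticNumbers p := by
  obtain ⟨α, hα, hTsum⟩ := exists_sum_sideForm_eq i₀ heq hTy
  have hy0 := hTy.pos
  have hk : (k : ℝ) ≠ 0 := by exact_mod_cast i₀.pos.ne'
  -- Vanishing corner sums are those of the empty set, whose empty dissection has sum `0`.
  have hempty : IsDissection ∅ (Fin.elim0 : Fin 0 → PlaneRectangle) :=
    ⟨Set.iUnion_of_empty _, fun i => i.elim0⟩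
  have hmem : ∀ s : ℝ, s ∈ Submodule.span ℚ {1, √(p : ℝ)} ↔ s ∈ quadraticNumbers p := by
    intro s
    rw [Submodule.mem_span_pair]
    simp only [Rat.smul_def, mul_one]
    exact exists_congr fun a => exists_congr fun b => eq_comm
  have hzero : ∀ f g : ℝ →+ ℝ, (∀ s ∈ quadraticNumbers p, f s = 0) →
      f α * g (y * α) + f (y * α) * g α = 0 := by
    intro f g hf
    have h1 : ∑ i, (T i).sideForm f g = 0 := by
      rw [hT.sum_sideForm_congr hempty f g]
      · exact Finset.sum_of_isEmpty _
      · intro e n hen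
        rw [M.cornerSum_eq_zero hT hen f g fun i j => hf _ (hM i j),
          hempty.cornerSum_eq_sum hen, Finset.sum_of_isEmpty]
    rw [hTsum] at h1
    exact (mul_eq_zero.1 h1).resolve_left hk
  -- If `s` and `t` are the two side lengths of the tiles, then `s` is in `ℚ[√p]`.
  have key : ∀ s t : ℝ, t ≠ 0 → (∀ f g : ℝ →+ ℝ, (∀ s ∈ quadraticNumbers p, f s = 0) →
      f s * g t + f t * g s = 0) → s ∈ quadraticNumbers p := by
    intro s t ht h
    by_contra hs
    rw [← hmem] at hs
    obtain ⟨φ, hφ, hker⟩ := Submodule.exists_le_ker_of_notMem hs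
    let f : ℝ →+ ℝ := (Rat.castHom ℝ).toAddMonoidHom.comp φ.toAddMonoidHom
    have hf : ∀ s, f s = φ s := fun s => rfl
    have hfs : f s ≠ 0 := by rw [hf]; exact_mod_cast hφ
    have hfK : ∀ s ∈ quadraticNumbers p, f s = 0 := fun s hs => by
      rw [hf, LinearMap.mem_ker.1 (hker ((hmem s).2 hs)), Rat.cast_zero]
    have h1 := h f f hfK
    have h2 := h f (AddMonoidHom.id ℝ) hfK
    have h3 : f t = 0 := (mul_eq_zero.1 (show f s * f t = 0 by linarith)).resolve_left hfs
    rw [h3, zero_mul, add_zero] at h2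
    exact mul_ne_zero hfs ht h2
  have h1 : α ∈ quadraticNumbers p := key α (y * α) (by positivity) hzero
  have h2 : y * α ∈ quadraticNumbers p := key (y * α) α hα.ne' fun f g hf => by
    rw [add_comm]; exact hzero f g hf
  have h3 := div_mem_quadraticNumbers hp hirr h1 h2
  rwa [mul_div_cancel_right₀ y hα.ne'] at h3

theorem mainTheorem1 (a b p : ℚ) (hp : 0 < p) (hirr : Irrational √(p : ℝ))
    (M : PolygonalRegion)
    (hM : ∀ (i : Fin M.numCurves) (j : Fin (M.numEdges i)),
      M.sideLength i j ∈ quadraticNumbers p)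
    (y : ℝ) (hy : CanBeCutIntoEqual M.carrier y)
    (R : PlaneRectangle) (hR : R.HasRatio y) :
    CanBeCutIntoSimilar M.carrier ((a : ℝ) + (b : ℝ) * √(p : ℝ)) ↔
      CanBeCutIntoSimilar R.carrier ((a : ℝ) + (b : ℝ) * √(p : ℝ)) := by
  obtain ⟨k, T, hT, heq, hTy⟩ := hy
  have hindex : ∀ {A : Set Plane} {k : ℕ} {T : Fin k → PlaneRectangle}, IsDissection A T →
      A.Nonempty → Nonempty (Fin k) := by
    rintro A k T hT ⟨z, hz⟩
    rw [← hT.1] at hz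
    obtain ⟨i, -⟩ := Set.mem_iUnion.1 hz
    exact ⟨i⟩
  obtain ⟨i₀⟩ := hindex hT M.isConnected.nonempty
  have hyK := M.ratio_mem_quadraticNumbers hp hirr hM hT i₀ heq (hTy i₀)
  constructor
  · rintro ⟨m, S, hS, hSx⟩
    obtain ⟨j₀⟩ := hindex hS M.isConnected.nonempty
    have hx := (hSx j₀).pos
    exact (isConicCombination_of_isDissection hp hirr hyK hT i₀ heq (hTy i₀) hS hSx
      hx).canBeCutIntoSimilar hx hR
  · rintro ⟨m, S, hS, hSx⟩
    obtain ⟨j₀⟩ := hindex hS ⟨R.corner, 0, by simp, 0, by simp, by simp⟩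
    have hx := (hSx j₀).pos
    -- The rectangle `R` is dissected into one rectangle with side ratio `y`.
    have hRR : IsDissection R.carrier (fun _ : Fin 1 => R) :=
      ⟨Set.iUnion_const _, fun i j hij => absurd (Subsingleton.elim i j) hij⟩
    have hxy := isConicCombination_of_isDissection hp hirr hyK hRR 0 (fun _ _ => rfl) hR hS hSx hx
    exact hT.canBeCutIntoSimilar fun i => hxy.canBeCutIntoSimilar hx (hTy i)
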